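/- Let $0<d^-\le d^+<\infty$ and let $p\in(1,\infty]$ satisfy $p>\max\{1,1/d^-\}$. There exist constants $\delta>0$ and $C>0$, depending only on $d^-$, $d^+$ and $p$, such that the following holds. Let $(d_j)_{j\ge1}$ be real numbers with $d^-\le d_j\le d^+$ for all $j\ge 1$, let $(\hat f(j))_{j\ge1}$ be complex numbers, and put \[ \rho=\rho(p)=\Bigl(\sum_{j=1}^\infty\frac{|\hat f(j)-1|^p}{j}\Bigr)^{1/p}\quad(p<\infty),\qquad \rho=\rho(\infty)=\sup_{j\ge1}|\hat f(j)-1|\quad(p=\infty). \] Define $p_n$ and $M_n$ as the power series coefficients \[ \sum_{n=0}^\infty p_nz^n=\exp\Bigl\{\sum_{j=1}^\infty\frac{d_j}{j}z^j\Bigr\},\qquad \sum_{n=0}^\infty M_nz^n=\exp\Bigl\{\sum_{j=1}^\infty\frac{d_j\hat f(j)}{j}z^j\Bigr\}, \] and let \[ m(z)=\exp\Bigl\{\sum_{j=1}^\infty d_j\,\frac{\hat f(j)-1}{j}\,z^j\Bigr\}. \] If $\rho\le\delta$, then the series in the definition of $m(z)$ converges absolutely for $|z|<1$, and for every $n\ge1$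 \[ \frac{M_n}{p_n}=m(e^{-1/n})\,(1+r_n)\qquad\text{with}\quad |r_n|\le C\rho . \] -/

import Mathlib

open scoped ENNReal

noncomputable section

namespace MeanValue

/-- The Taylor coefficient `[z^n] exp {∑_{j ≥ 1} (a_j / j) z^j}`. The value `a 0` is not used. -/
def expCoeff (a : ℕ → ℂ) (n : ℕ) : ℂ :=
  PowerSeries.coeff n
    ((PowerSeries.exp ℂ).subst
      (PowerSeries.mk fun j : ℕ => if j = 0 then (0 : ℂ) else a j / (j : ℂ)))

/-- `p_n = [z^n] exp {∑_{j ≥ 1} (d_j / j) z^j}`. -/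
def pCoeff (d : ℕ → ℝ) (n : ℕ) : ℂ :=
  expCoeff (fun j => (d j : ℂ)) n

/-- `M_n = [z^n] exp {∑_{j ≥ 1} (d_j f_j / j) z^j}`. -/
def MCoeff (d : ℕ → ℝ) (f : ℕ → ℂ) (n : ℕ) : ℂ :=
  expCoeff (fun j => (d j : ℂ) * f j) n

/-- The summand of index `j + 1` of the series `L(z) = ∑_{j ≥ 1} d_j ((f_j - 1) / j) z^j`. -/
def LTerm (d : ℕ → ℝ) (f : ℕ → ℂ) (z : ℂ) (j : ℕ) : ℂ :=
  (d (j + 1) : ℂ) * ((f (j + 1) - 1) / ((j + 1 : ℕ) : ℂ)) * z ^ (j + 1)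

/-- `m(z) = exp {∑_{j ≥ 1} d_j ((f_j - 1) / j) z^j}`. -/
def mFun (d : ℕ → ℝ) (f : ℕ → ℂ) (z : ℂ) : ℂ :=
  Complex.exp (∑' j : ℕ, LTerm d f z j)

/-- `ρ(p) = (∑_{j ≥ 1} |f_j - 1|^p / j)^{1/p}` for finite `p`, and
`ρ(∞) = sup_{j ≥ 1} |f_j - 1|`; the value is `∞` if the series diverges
(respectively, if the sequence is unbounded). -/
def rho (f : ℕ → ℂ) (p : ℝ≥0∞) : ℝ≥0∞ :=
  if p = ∞ then ⨆ j : ℕ, ‖f (j + 1) - 1‖ₑ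
  else (∑' j : ℕ, ‖f (j + 1) - 1‖ₑ ^ p.toReal / ((j + 1 : ℕ) : ℝ≥0∞)) ^ (1 / p.toReal)

end MeanValue

end

/-!
By the recurrence `n p_n = ∑_{j < n} d_{n-j} p_j`, the ratio `a n = M_n / p_n` equals the average of
its own past values `a j`, `j < n`, with weights `d_{n-j} p_j / (n p_n)`, up to an error of relative
size `O(ρ)` coming from Hölder's inequality; this is where `p > 1 / d⁻` enters.

On the multiplicative scale `n / (j + 1)` these weights have bounded moments of a small positive
order, they drift towards the past, and the weights belonging to comparable indices have mass in
common. As in Harris' ergodic theorem, averaging therefore contracts the oscillation of `a` by a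
fixed factor, so by induction `a j - a n = O(ρ |a n|)` up to a small power of the ratio of the
indices.

The generating functions give `m(x) = ∑ a_j p_j x^j / ∑ p_j x^j`. At `x = exp (-1 / n)` this average
is concentrated on indices comparable to `n`, hence `m(x) = a n (1 + O(ρ))`.
-/

namespace MeanValue

section GeneratingFunction

open FormalMultilinearSeries

theorem hasSubst_mk_div (a : ℕ → ℂ) :
    PowerSeries.HasSubst (PowerSeries.mk fun j : ℕ => if j = 0 then (0 : ℂ) else a j / (j : ℂ)) :=
  PowerSeries.HasSubst.of_constantCoeff_zero' (by
    rw [← PowerSeries.coeff_zero_eq_constantCoeff_apply, PowerSeries.coeff_mk, if_pos rfl])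

theorem expCoeff_zero (a : ℕ → ℂ) : expCoeff a 0 = 1 := by
  rw [expCoeff, PowerSeries.coeff_subst' (hasSubst_mk_div a), finsum_eq_single _ 0]
  · simp
  · intro n hn
    simp [hn]

theorem succ_mul_expCoeff_succ (a : ℕ → ℂ) (n : ℕ) :
    ((n : ℂ) + 1) * expCoeff a (n + 1) =
      ∑ j ∈ Finset.range (n + 1), expCoeff a j * a (n - j + 1) := by
  have h := congrArg (PowerSeries.coeff n)
    (PowerSeries.derivative_subst (f := PowerSeries.exp ℂ) (hasSubst_mk_div a))
  rw [PowerSeries.derivative_exp, PowerSeries.coeff_derivative, PowerSeries.coeff_mul,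
    Finset.Nat.sum_antidiagonal_eq_sum_range_succ_mk] at h
  rw [mul_comm, expCoeff, h]
  refine Finset.sum_congr rfl fun j _ => ?_
  have hj : ((n - j : ℕ) : ℂ) + 1 ≠ 0 := (n - j).cast_add_one_ne_zero
  rw [PowerSeries.coeff_derivative, PowerSeries.coeff_mk, if_neg (n - j).succ_ne_zero, expCoeff]
  push_cast
  rw [div_mul_cancel₀ _ hj]

theorem mul_expCoeff (a : ℕ → ℂ) (n : ℕ) :
    (n : ℂ) * expCoeff a n = ∑ j ∈ Finset.range n, a (n - j) * expCoeff a j := by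
  cases n with
  | zero => simp
  | succ n =>
    push_cast
    rw [succ_mul_expCoeff_succ]
    refine Finset.sum_congr rfl fun j hj => ?_
    rw [← Nat.sub_add_comm (Finset.mem_range_succ_iff.1 hj), mul_comm]

theorem hasFPowerSeriesOnBall_ofScalarsSum {𝕜 : Type*} [RCLike 𝕜] {c : ℕ → 𝕜} {r : NNReal}
    (hr : 0 < r) (hc : ∀ z : 𝕜, ‖z‖ < r → Summable fun n => c n * z ^ n) :
    HasFPowerSeriesOnBall (ofScalarsSum (E := 𝕜) c) (ofScalars 𝕜 c) 0 r := by
  have hradius : (r : ℝ≥0∞) ≤ (ofScalars 𝕜 c).radius := by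
    refine ENNReal.le_of_forall_nnreal_lt fun s hs => le_radius_of_summable _ ?_
    have hs' : ‖((s : ℝ) : 𝕜)‖ = s := by simp
    have hsum := (hc ((s : ℝ) : 𝕜) (hs'.trans_lt (by exact_mod_cast hs))).norm
    simpa only [ofScalars_norm, norm_mul, norm_pow, hs'] using hsum
  exact ((ofScalars 𝕜 c).hasFPowerSeriesOnBall
    ((ENNReal.coe_pos.2 hr).trans_le hradius)).mono (ENNReal.coe_pos.2 hr) hradius

theorem iteratedDeriv_eq_factorial_mul {𝕜 : Type*} [RCLike 𝕜] {f : 𝕜 → 𝕜}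
    {c : ℕ → 𝕜} {x : 𝕜} (hf : HasFPowerSeriesAt f (ofScalars 𝕜 c) x) (n : ℕ) :
    iteratedDeriv n f x = n.factorial * c n := by
  obtain ⟨r, hr⟩ := hf
  rw [iteratedDeriv_eq_iteratedFDeriv, ← hr.factorial_smul 1 n]
  simp [nsmul_eq_mul]

/-- Both sides solve the recurrence obtained by differentiating `exp G` with the Leibniz rule. -/
theorem iteratedDeriv_exp_comp_eq_factorial_mul_expCoeff {a : ℕ → ℂ} {G : ℂ → ℂ}
    (hG : AnalyticAt ℂ G 0) (hG0 : G 0 = 0)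
    (ha : ∀ n : ℕ, iteratedDeriv (n + 1) G 0 = n.factorial * a (n + 1)) (n : ℕ) :
    iteratedDeriv n (fun z => Complex.exp (G z)) 0 = n.factorial * expCoeff a n := by
  induction n using Nat.strong_induction_on with
  | _ n ih =>
    cases n with
    | zero => simp [hG0, expCoeff_zero]
    | succ n =>
      have hF : AnalyticAt ℂ (fun z => Complex.exp (G z)) 0 := hG.cexp
      have hderiv : deriv (fun z => Complex.exp (G z)) =ᶠ[nhds 0]
          (fun z => Complex.exp (G z)) * deriv G := by
        filter_upwards [hG.eventually_analyticAt] with z hz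
        exact (hz.differentiableAt.hasDerivAt.cexp).deriv
      rw [iteratedDeriv_succ', hderiv.iteratedDeriv_eq,
        iteratedDeriv_mul hF.contDiffAt hG.deriv.contDiffAt, Nat.factorial_succ, mul_comm (n + 1)]
      push_cast
      rw [mul_assoc, succ_mul_expCoeff_succ, Finset.mul_sum]
      refine Finset.sum_congr rfl fun i hi => ?_
      have hi' : i ≤ n := Finset.mem_range_succ_iff.1 hi
      have hchoose : ((n.choose i : ℂ) * i.factorial) * (n - i).factorial = n.factorial := by
        exact_mod_cast Nat.choose_mul_factorial_mul_factorial hi'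
      rw [ih i (by omega), ← iteratedDeriv_succ', ha, ← hchoose]
      ring

theorem hasSum_expCoeff {a : ℕ → ℂ}
    (ha : ∀ z : ℂ, ‖z‖ < 1 → Summable fun j : ℕ => a (j + 1) / ((j + 1 : ℕ) : ℂ) * z ^ (j + 1))
    {z : ℂ} (hz : ‖z‖ < 1) :
    HasSum (fun n => expCoeff a n * z ^ n)
      (Complex.exp (∑' j : ℕ, a (j + 1) / ((j + 1 : ℕ) : ℂ) * z ^ (j + 1))) := by
  set g : ℕ → ℂ := fun j => if j = 0 then 0 else a j / (j : ℂ) with hg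
  have hg_succ (j : ℕ) : g (j + 1) = a (j + 1) / ((j + 1 : ℕ) : ℂ) := if_neg j.succ_ne_zero
  have hsum (w : ℂ) (hw : ‖w‖ < 1) : Summable fun j => g j * w ^ j :=
    (summable_nat_add_iff 1).1 (by simpa only [hg_succ] using ha w hw)
  have hG_series := hasFPowerSeriesOnBall_ofScalarsSum one_pos hsum
  set G : ℂ → ℂ := ofScalarsSum g
  have hG (w : ℂ) (hw : ‖w‖ < 1) :
      G w = ∑' j : ℕ, a (j + 1) / ((j + 1 : ℕ) : ℂ) * w ^ (j + 1) := by
    simp only [G, ofScalarsSum_eq_tsum, smul_eq_mul, (hsum w hw).tsum_eq_zero_add, hg_succ]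
    simp [hg]
  have hG0 : G 0 = 0 := by simpa using hG 0 (by simp)
  have hG_diff : DifferentiableOn ℂ G (Metric.ball 0 1) := by
    simpa [← Metric.eball_ofReal] using hG_series.differentiableOn
  have hderiv (n : ℕ) : iteratedDeriv (n + 1) G 0 = n.factorial * a (n + 1) := by
    have hn : ((n + 1 : ℕ) : ℂ) ≠ 0 := Nat.cast_ne_zero.2 n.succ_ne_zero
    rw [iteratedDeriv_eq_factorial_mul hG_series.hasFPowerSeriesAt, Nat.factorial_succ, hg_succ,
      Nat.cast_mul]
    field_simp
  have htaylor := Complex.hasSum_taylorSeries_on_ball hG_diff.cexp (mem_ball_zero_iff.2 hz)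
  rw [hG z hz] at htaylor
  refine htaylor.congr_fun fun n => ?_
  have hn : (n.factorial : ℂ) ≠ 0 := Nat.cast_ne_zero.2 n.factorial_ne_zero
  rw [iteratedDeriv_exp_comp_eq_factorial_mul_expCoeff hG_series.analyticAt hG0 hderiv,
    smul_eq_mul, smul_eq_mul, sub_zero]
  field_simp

end GeneratingFunction

section Real

theorem rpow_sub_one_le {y ε β : ℝ} (hy : 1 ≤ y) (hβ : 0 < β) (hε : 0 ≤ ε) (hεβ : ε ≤ β / 2) :
    y ^ ε - 1 ≤ ε * (2 / β) * y ^ β := by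
  have hy0 : 0 < y := one_pos.trans_le hy
  have : 0 ≤ Real.log y := Real.log_nonneg hy
  have hexp : y ^ ε - 1 ≤ ε * Real.log y * y ^ ε := by
    have h := Real.one_sub_le_exp_neg (Real.log y * ε)
    rw [Real.exp_neg, ← Real.rpow_def_of_pos hy0, ← one_div, le_div_iff₀ (by positivity)] at h
    linarith
  have hlog : Real.log y ≤ y ^ (β / 2) / (β / 2) := Real.log_le_rpow_div hy0.le (by positivity)
  calc y ^ ε - 1 ≤ ε * Real.log y * y ^ ε := hexp
    _ ≤ ε * (y ^ (β / 2) / (β / 2)) * y ^ (β / 2) := by gcongr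
    _ = ε * (2 / β) * (y ^ (β / 2) * y ^ (β / 2)) := by field_simp
    _ = ε * (2 / β) * y ^ β := by rw [← Real.rpow_add hy0, add_halves]

theorem max_div_div_rpow_le {y r ε β : ℝ} (hy : 1 ≤ y) (hr : 0 < r) (hβ : 0 < β) (hε : 0 ≤ ε)
    (hε1 : ε ≤ 1) (hεβ : ε ≤ β / 4) :
    max (y / r) (r / y) ^ ε ≤ r ^ ε * (1 + ε * (y⁻¹ - 1) + ε * (4 / β) * (y / r) ^ β) := by
  have hy0 : 0 < y := one_pos.trans_le hy
  have hbernoulli : y⁻¹ ^ ε ≤ 1 + ε * (y⁻¹ - 1) := by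
    have h := rpow_one_add_le_one_add_mul_self (s := y⁻¹ - 1)
      (by linarith [inv_pos.2 hy0]) hε hε1
    rwa [add_sub_cancel] at h
  rcases le_total y r with hyr | hyr
  · have hmax : max (y / r) (r / y) = r * y⁻¹ := by
      rw [max_eq_right, div_eq_mul_inv]
      exact ((div_le_one hr).2 hyr).trans ((one_le_div hy0).2 hyr)
    rw [hmax, Real.mul_rpow hr.le (by positivity)]
    gcongr
    exact hbernoulli.trans (le_add_of_nonneg_right (by positivity))
  · have hmax : max (y / r) (r / y) = r * y⁻¹ * ((y / r) * (y / r)) := by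
      rw [max_eq_left (((div_le_one hy0).2 hyr).trans ((one_le_div hr).2 hyr))]
      field_simp
    have hle_one : y⁻¹ ^ ε ≤ 1 := Real.rpow_le_one (by positivity) (inv_le_one_of_one_le₀ hy) hε
    have hgrowth := rpow_sub_one_le ((one_le_div hr).2 hyr) hβ (ε := 2 * ε)
      (by linarith) (by linarith)
    rw [hmax, Real.mul_rpow (by positivity) (by positivity), Real.mul_rpow hr.le (by positivity),
      Real.mul_rpow (by positivity) (by positivity), ← Real.rpow_add (by positivity), ← two_mul,
      mul_assoc]
    gcongr
    calc y⁻¹ ^ ε * (y / r) ^ (2 * ε)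
        ≤ y⁻¹ ^ ε * (1 + ε * (4 / β) * (y / r) ^ β) := by
          gcongr
          linarith [show 2 * ε * (2 / β) * (y / r) ^ β = ε * (4 / β) * (y / r) ^ β by ring]
      _ = y⁻¹ ^ ε + y⁻¹ ^ ε * (ε * (4 / β) * (y / r) ^ β) := by ring
      _ ≤ 1 + ε * (y⁻¹ - 1) + ε * (4 / β) * (y / r) ^ β :=
          add_le_add hbernoulli (mul_le_of_le_one_left (by positivity) hle_one)

end Real

section Coupling

variable {ι E : Type*} [NormedAddCommGroup E] [NormedSpace ℝ E] {s : Finset ι} {a : ι → E}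
  {e : ι → ℝ} {T : ℝ}

theorem norm_sum_smul_sub_sum_smul_le {x z : ι → ℝ} {m : ℝ} (hm : 0 < m)
    (hx : ∀ j ∈ s, 0 ≤ x j) (hz : ∀ j ∈ s, 0 ≤ z j)
    (hxm : ∑ j ∈ s, x j = m) (hzm : ∑ j ∈ s, z j = m)
    (ha : ∀ j ∈ s, ∀ k ∈ s, ‖a j - a k‖ ≤ T * (1 + e j + e k)) :
    ‖∑ j ∈ s, x j • a j - ∑ k ∈ s, z k • a k‖ ≤
      T * (m + ∑ j ∈ s, x j * e j + ∑ k ∈ s, z k * e k) := by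
  have hpairs : m • (∑ j ∈ s, x j • a j - ∑ k ∈ s, z k • a k) =
      ∑ j ∈ s, ∑ k ∈ s, (x j * z k) • (a j - a k) := by
    simp only [smul_sub, Finset.sum_sub_distrib]
    congr 1
    · simp only [← Finset.sum_smul, ← Finset.mul_sum, hzm, Finset.smul_sum, smul_smul, mul_comm m]
    · rw [Finset.sum_comm]
      simp only [← Finset.sum_smul, ← Finset.sum_mul, hxm, Finset.smul_sum, smul_smul]
  have hsum : ∑ j ∈ s, ∑ k ∈ s, (x j * z k) * (T * (1 + e j + e k)) =
      m * (T * (m + ∑ j ∈ s, x j * e j + ∑ k ∈ s, z k * e k)) := by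
    have hinner (j : ι) : ∑ k ∈ s, (x j * z k) * (T * (1 + e j + e k)) =
        T * (x j * m + x j * e j * m + x j * ∑ k ∈ s, z k * e k) := by
      simp only [← hzm, Finset.mul_sum, ← Finset.sum_add_distrib]
      exact Finset.sum_congr rfl fun k _ => by ring
    simp only [hinner, ← Finset.mul_sum, Finset.sum_add_distrib, ← Finset.sum_mul, hxm]
    ring
  refine le_of_mul_le_mul_left ?_ hm
  calc m * ‖∑ j ∈ s, x j • a j - ∑ k ∈ s, z k • a k‖
      = ‖∑ j ∈ s, ∑ k ∈ s, (x j * z k) • (a j - a k)‖ := by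
        rw [← hpairs, norm_smul, Real.norm_of_nonneg hm.le]
    _ ≤ ∑ j ∈ s, ∑ k ∈ s, (x j * z k) * (T * (1 + e j + e k)) := by
        refine norm_sum_le_of_le _ fun j hj => norm_sum_le_of_le _ fun k hk => ?_
        have hxz := mul_nonneg (hx j hj) (hz k hk)
        rw [norm_smul, Real.norm_of_nonneg hxz]
        exact mul_le_mul_of_nonneg_left (ha j hj k hk) hxz
    _ = _ := hsum

/-- The common part `v` of the two averages cancels; the remainders are coupled independently. -/
theorem norm_sum_smul_sub_sum_smul_le_of_overlap {w w' v : ι → ℝ} (hT : 0 ≤ T)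
    (he : ∀ j ∈ s, 0 ≤ e j) (hv : ∀ j ∈ s, 0 ≤ v j) (hvw : ∀ j ∈ s, v j ≤ w j)
    (hvw' : ∀ j ∈ s, v j ≤ w' j) (hw : ∑ j ∈ s, w j = 1) (hw' : ∑ j ∈ s, w' j = 1)
    (ha : ∀ j ∈ s, ∀ k ∈ s, ‖a j - a k‖ ≤ T * (1 + e j + e k)) :
    ‖∑ j ∈ s, w j • a j - ∑ j ∈ s, w' j • a j‖ ≤
      T * (1 - ∑ j ∈ s, v j + ∑ j ∈ s, w j * e j + ∑ j ∈ s, w' j * e j) := by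
  have hmass (u : ι → ℝ) (hu : ∑ j ∈ s, u j = 1) :
      ∑ j ∈ s, (u j - v j) = 1 - ∑ j ∈ s, v j := by
    rw [Finset.sum_sub_distrib, hu]
  have hdiff : ∑ j ∈ s, w j • a j - ∑ j ∈ s, w' j • a j =
      ∑ j ∈ s, (w j - v j) • a j - ∑ j ∈ s, (w' j - v j) • a j := by
    simp only [sub_smul, Finset.sum_sub_distrib, sub_sub_sub_cancel_right]
  have hremainder (u : ι → ℝ) : ∑ j ∈ s, (u j - v j) * e j ≤ ∑ j ∈ s, u j * e j :=
    Finset.sum_le_sum fun j hj =>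
      mul_le_mul_of_nonneg_right (sub_le_self _ (hv j hj)) (he j hj)
  have hnonneg {u : ι → ℝ} (hu : ∀ j ∈ s, v j ≤ u j) : ∀ j ∈ s, 0 ≤ u j - v j :=
    fun j hj => sub_nonneg.2 (hu j hj)
  rcases (hmass w hw ▸ Finset.sum_nonneg (hnonneg hvw)).eq_or_lt with hm | hm
  · have heq {u : ι → ℝ} (hu : ∀ j ∈ s, v j ≤ u j) (hu1 : ∑ j ∈ s, u j = 1) :
        ∀ j ∈ s, u j - v j = 0 :=
      (Finset.sum_eq_zero_iff_of_nonneg (hnonneg hu)).1 ((hmass u hu1).trans hm.symm)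
    have hzero : ∑ j ∈ s, w j • a j = ∑ j ∈ s, w' j • a j :=
      Finset.sum_congr rfl fun j hj => by
        rw [sub_eq_zero.1 (heq hvw hw j hj), sub_eq_zero.1 (heq hvw' hw' j hj)]
    rw [hzero, sub_self, norm_zero, ← hm]
    have hsum {u : ι → ℝ} (hu : ∀ j ∈ s, v j ≤ u j) : 0 ≤ ∑ j ∈ s, u j * e j :=
      Finset.sum_nonneg fun j hj => mul_nonneg ((hv j hj).trans (hu j hj)) (he j hj)
    exact mul_nonneg hT (add_nonneg (add_nonneg le_rfl (hsum hvw)) (hsum hvw'))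
  · rw [hdiff]
    refine (norm_sum_smul_sub_sum_smul_le hm (hnonneg hvw) (hnonneg hvw') (hmass w hw)
      (hmass w' hw') ha).trans ?_
    gcongr T * (_ + ?_ + ?_)
    · exact hremainder w
    · exact hremainder w'

end Coupling

section Harris

/-- A kernel on `ℕ` whose `n`-th row is a probability vector on the indices below `n`, satisfying
the hypotheses of Harris' ergodic theorem on the multiplicative scale `n / (j + 1)`: moments of
order `β` bounded by `C`, drift towards the past by a factor `1 - c`, and common mass at least `κ R`
of any two rows whose indices have ratio at most `R`. Row `0` is the unit mass at `0`, which is why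
row `n` is supported below `max n 1`. -/
structure HarrisKernel (β C c : ℝ) (κ : ℝ → ℝ) (w : ℕ → ℕ → ℝ) : Prop where
  nonneg : ∀ n j, 0 ≤ w n j
  eq_zero : ∀ n j, max n 1 ≤ j → w n j = 0
  sum_eq_one : ∀ n, ∑ j ∈ Finset.range (max n 1), w n j = 1
  moment : ∀ n, ∑ j ∈ Finset.range (max n 1),
    w n j * (((max n 1 : ℕ) : ℝ) / ((j : ℝ) + 1)) ^ β ≤ C
  drift : ∀ n, 2 ≤ n → ∑ j ∈ Finset.range n, w n j * (((j : ℝ) + 1) / n) ≤ 1 - c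
  overlap : ∀ (R : ℝ) (i n : ℕ), i < n → (n : ℝ) ≤ R * ((i : ℝ) + 1) →
    ∃ v : ℕ → ℝ, (∀ j, 0 ≤ v j ∧ v j ≤ w n j ∧ v j ≤ w i j) ∧
      κ R ≤ ∑ j ∈ Finset.range n, v j

variable {E : Type*} [NormedAddCommGroup E] {w : ℕ → ℕ → ℝ} {a s : ℕ → E}
  {β C c γ τ ε σ ε₀ R : ℝ} {κ : ℝ → ℝ} {i n : ℕ}

theorem one_le_div_add_one {j n : ℕ} (hj : j < n) : 1 ≤ (n : ℝ) / ((j : ℝ) + 1) :=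
  (one_le_div (by positivity)).2 (by exact_mod_cast hj)

theorem div_max_one_le (hiR : (n : ℝ) ≤ R * ((i : ℝ) + 1)) :
    (n : ℝ) / (max i 1 : ℕ) ≤ 2 * R := by
  have hI : (0 : ℝ) < (max i 1 : ℕ) := by exact_mod_cast (by omega : 0 < max i 1)
  have hI2 : (i : ℝ) + 1 ≤ 2 * (max i 1 : ℕ) := by exact_mod_cast (by omega)
  have : 0 ≤ R := nonneg_of_mul_nonneg_left (n.cast_nonneg.trans hiR) (by positivity)
  rw [div_le_iff₀ hI]
  nlinarith

namespace HarrisKernel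

theorem sum_smul_eq {F : Type*} [AddCommMonoid F] [Module ℝ F] (h : HarrisKernel β C c κ w)
    {N : ℕ} (hN : max n 1 ≤ N) (φ : ℕ → F) :
    ∑ j ∈ Finset.range N, w n j • φ j = ∑ j ∈ Finset.range (max n 1), w n j • φ j := by
  refine (Finset.sum_subset (Finset.range_mono hN) fun j _ hj => ?_).symm
  rw [h.eq_zero n j (not_lt.1 (mt Finset.mem_range.2 hj)), zero_smul]

theorem sum_eq_one_of_le (h : HarrisKernel β C c κ w) {N : ℕ} (hN : max n 1 ≤ N) :
    ∑ j ∈ Finset.range N, w n j = 1 := by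
  simpa [h.sum_eq_one] using h.sum_smul_eq hN fun _ => (1 : ℝ)

theorem moment_self (h : HarrisKernel β C c κ w) (hn : 1 ≤ n) :
    ∑ j ∈ Finset.range n, w n j * ((n : ℝ) / ((j : ℝ) + 1)) ^ β ≤ C := by
  simpa only [max_eq_left hn] using h.moment n

theorem moment_of_lt (h : HarrisKernel β C c κ w) (hβ : 0 ≤ β) (hβ1 : β ≤ 1) (hR : 1 ≤ R)
    (hi : i < n) (hiR : (n : ℝ) ≤ R * ((i : ℝ) + 1)) :
    ∑ j ∈ Finset.range n, w i j * ((n : ℝ) / ((j : ℝ) + 1)) ^ β ≤ 2 * R * C := by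
  have hI : (0 : ℝ) < (max i 1 : ℕ) := by exact_mod_cast (by omega : 0 < max i 1)
  have hpow : ((n : ℝ) / (max i 1 : ℕ)) ^ β ≤ 2 * R :=
    (Real.rpow_le_rpow (by positivity) (div_max_one_le hiR) hβ).trans
      (Real.rpow_le_self_of_one_le (by linarith) hβ1)
  have hsplit := h.sum_smul_eq (n := i) (N := n) (by omega)
    fun j => ((n : ℝ) / ((j : ℝ) + 1)) ^ β
  simp only [smul_eq_mul] at hsplit
  calc ∑ j ∈ Finset.range n, w i j * ((n : ℝ) / ((j : ℝ) + 1)) ^ β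
      = ((n : ℝ) / (max i 1 : ℕ)) ^ β *
          ∑ j ∈ Finset.range (max i 1), w i j * (((max i 1 : ℕ) : ℝ) / ((j : ℝ) + 1)) ^ β := by
        rw [hsplit, Finset.mul_sum]
        refine Finset.sum_congr rfl fun j _ => ?_
        rw [mul_left_comm, ← Real.mul_rpow (by positivity) (by positivity),
          div_mul_div_cancel₀ hI.ne']
    _ ≤ 2 * R * C := by
        gcongr
        · exact Finset.sum_nonneg fun j _ => mul_nonneg (h.nonneg i j) (by positivity)
        · exact h.moment i

theorem moment_nonneg (h : HarrisKernel β C c κ w) : 0 ≤ C :=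
  (Finset.sum_nonneg fun j _ => mul_nonneg (h.nonneg 0 j) (by positivity)).trans (h.moment 0)

end HarrisKernel

/-- The error `s n` is at most `σ` times any bound on the past of `a`, where the past is allowed
to grow like `(n / (j + 1)) ^ ε₀` in the direction of small indices `j`. -/
def IsPastError (a s : ℕ → E) (σ ε₀ : ℝ) : Prop :=
  ∀ n, 1 ≤ n → ∀ X : ℝ, 0 ≤ X →
    (∀ j < n, ‖a j‖ ≤ X * ((n : ℝ) / ((j : ℝ) + 1)) ^ ε₀) → ‖s n‖ ≤ σ * X

/-- The relative oscillation of `a` below `n` is at most `τ` on the scale of the weight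
`((i + 1) / (j + 1)) ^ ε`. -/
def OscillationBelow (a : ℕ → E) (τ ε : ℝ) (n : ℕ) : Prop :=
  ∀ i < n, ∀ j ≤ i, ‖a j - a i‖ ≤ τ * ‖a i‖ * (((i : ℝ) + 1) / ((j : ℝ) + 1)) ^ ε

namespace OscillationBelow

theorem norm_le (ho : OscillationBelow a τ ε n) (hi : i < n) :
    ‖a i‖ ≤ ‖a (n - 1)‖ * (1 + τ * ((n : ℝ) / ((i : ℝ) + 1)) ^ ε) := by
  have h := ho (n - 1) (by omega) i (by omega)
  have hn : ((n - 1 : ℕ) : ℝ) + 1 = n := by exact_mod_cast (by omega : n - 1 + 1 = n)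
  rw [hn] at h
  linarith [norm_sub_norm_le (a i) (a (n - 1))]

theorem norm_le_two_mul (ho : OscillationBelow a τ ε n) (hτ : τ ≤ 1) (hε : 0 ≤ ε) (hε₀ : ε ≤ ε₀)
    (hi : i < n) : ‖a i‖ ≤ 2 * ‖a (n - 1)‖ * ((n : ℝ) / ((i : ℝ) + 1)) ^ ε₀ := by
  have hr := one_le_div_add_one hi
  have hle : ((n : ℝ) / ((i : ℝ) + 1)) ^ ε ≤ ((n : ℝ) / ((i : ℝ) + 1)) ^ ε₀ :=
    Real.rpow_le_rpow_of_exponent_le hr hε₀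
  have hone : 1 ≤ ((n : ℝ) / ((i : ℝ) + 1)) ^ ε := Real.one_le_rpow hr hε
  calc ‖a i‖ ≤ ‖a (n - 1)‖ * (1 + τ * ((n : ℝ) / ((i : ℝ) + 1)) ^ ε) := ho.norm_le hi
    _ ≤ ‖a (n - 1)‖ * (2 * ((n : ℝ) / ((i : ℝ) + 1)) ^ ε₀) := by gcongr; nlinarith
    _ = _ := by ring

theorem norm_sub_le_of_le (ho : OscillationBelow a τ ε n) (hτ : 0 ≤ τ) {j k : ℕ} (hjk : j ≤ k)
    (hk : k < n) : ‖a j - a k‖ ≤ τ * ‖a (n - 1)‖ *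
      ((((k : ℝ) + 1) / ((j : ℝ) + 1)) ^ ε + τ * ((n : ℝ) / ((j : ℝ) + 1)) ^ ε) := by
  have hmul : ((n : ℝ) / ((k : ℝ) + 1)) ^ ε * (((k : ℝ) + 1) / ((j : ℝ) + 1)) ^ ε =
      ((n : ℝ) / ((j : ℝ) + 1)) ^ ε := by
    rw [← Real.mul_rpow (by positivity) (by positivity), div_mul_div_cancel₀ (by positivity)]
  calc ‖a j - a k‖ ≤ τ * ‖a k‖ * (((k : ℝ) + 1) / ((j : ℝ) + 1)) ^ ε := ho k hk j hjk
    _ ≤ τ * (‖a (n - 1)‖ * (1 + τ * ((n : ℝ) / ((k : ℝ) + 1)) ^ ε)) *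
          (((k : ℝ) + 1) / ((j : ℝ) + 1)) ^ ε := by gcongr; exact ho.norm_le hk
    _ = τ * ‖a (n - 1)‖ * ((((k : ℝ) + 1) / ((j : ℝ) + 1)) ^ ε +
          τ * (((n : ℝ) / ((k : ℝ) + 1)) ^ ε * (((k : ℝ) + 1) / ((j : ℝ) + 1)) ^ ε)) := by ring
    _ = _ := by rw [hmul]

/-- The two cases `j ≤ i` and `i ≤ j` in terms of `y = n / (j + 1)` and `r = n / (i + 1)`. -/
theorem norm_sub_le_max (ho : OscillationBelow a τ ε n) (hτ : 0 ≤ τ) {j : ℕ} (hi : i < n)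
    (hj : j < n) {y r : ℝ} (hy : y = (n : ℝ) / ((j : ℝ) + 1)) (hr : r = (n : ℝ) / ((i : ℝ) + 1)) :
    ‖a j - a i‖ ≤ τ * ‖a (n - 1)‖ * (max (y / r) (r / y) ^ ε + τ * max r y ^ ε) := by
  have hn : (n : ℝ) ≠ 0 := Nat.cast_ne_zero.2 (by omega)
  have hyr : y / r = ((i : ℝ) + 1) / ((j : ℝ) + 1) := by rw [hy, hr]; field_simp
  have hry : r / y = ((j : ℝ) + 1) / ((i : ℝ) + 1) := by rw [hy, hr]; field_simp
  rcases le_total j i with hji | hij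
  · have hij' : (j : ℝ) + 1 ≤ (i : ℝ) + 1 := by exact_mod_cast Nat.succ_le_succ hji
    have hmax : max (y / r) (r / y) = ((i : ℝ) + 1) / ((j : ℝ) + 1) := by
      rw [hyr, hry, max_eq_left]
      exact ((div_le_one (by positivity)).2 hij').trans ((one_le_div (by positivity)).2 hij')
    rw [hmax, max_eq_right (by rw [hy, hr]; gcongr), hy]
    exact ho.norm_sub_le_of_le hτ hji hi
  · have hij' : (i : ℝ) + 1 ≤ (j : ℝ) + 1 := by exact_mod_cast Nat.succ_le_succ hij
    have hmax : max (y / r) (r / y) = ((j : ℝ) + 1) / ((i : ℝ) + 1) := by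
      rw [hyr, hry, max_eq_right]
      exact ((div_le_one (by positivity)).2 hij').trans ((one_le_div (by positivity)).2 hij')
    rw [hmax, max_eq_left (by rw [hy, hr]; gcongr), hr, norm_sub_rev]
    exact ho.norm_sub_le_of_le hτ hij hj

theorem norm_sub_le_mul_moment (ho : OscillationBelow a τ ε n) (hτ : 0 ≤ τ) (hβ : 0 < β)
    (hε : 0 ≤ ε) (hε1 : ε ≤ 1) (hεβ : ε ≤ β / 4) {j : ℕ} (hi : i < n) (hj : j < n) :
    ‖a j - a i‖ ≤ τ * ‖a (n - 1)‖ * ((n : ℝ) / ((i : ℝ) + 1)) ^ ε *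
      (1 + ε * (((j : ℝ) + 1) / n - 1) +
        ε * (4 / β) * ((n : ℝ) / ((j : ℝ) + 1)) ^ β / ((n : ℝ) / ((i : ℝ) + 1)) ^ β +
        τ * (1 + ((n : ℝ) / ((j : ℝ) + 1)) ^ β)) := by
  have hy := one_le_div_add_one hj
  have hr := one_le_div_add_one hi
  rw [← inv_div (n : ℝ) ((j : ℝ) + 1)]
  refine (ho.norm_sub_le_max hτ hi hj rfl rfl).trans ?_
  set y := (n : ℝ) / ((j : ℝ) + 1)
  set r := (n : ℝ) / ((i : ℝ) + 1)
  have hr_pow : 1 ≤ r ^ ε := Real.one_le_rpow hr hε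
  have hy_pow : y ^ ε ≤ y ^ β := Real.rpow_le_rpow_of_exponent_le hy (by linarith)
  have hratio := max_div_div_rpow_le hy (one_pos.trans_le hr) hβ hε hε1 hεβ
  have hmax : max r y ^ ε ≤ r ^ ε * (1 + y ^ β) := by
    have hy0 : 0 ≤ y ^ β := by positivity
    rcases max_cases r y with ⟨h, _⟩ | ⟨h, _⟩ <;> rw [h] <;> nlinarith
  rw [Real.div_rpow (x := y) (by positivity) (by positivity), ← mul_div_assoc] at hratio
  rw [mul_assoc _ (r ^ ε), mul_add (r ^ ε), mul_left_comm (r ^ ε)]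
  gcongr

theorem norm_sub_le_add_moment (ho : OscillationBelow a τ ε n) (hτ : 0 ≤ τ) (hβ : 0 < β)
    (hε : 0 ≤ ε) (hεβ : ε ≤ β / 2) {j k : ℕ} (hj : j < n) (hk : k < n) :
    ‖a j - a k‖ ≤ τ * ‖a (n - 1)‖ * (1 + τ) *
      (1 + ε * (2 / β) * ((n : ℝ) / ((j : ℝ) + 1)) ^ β +
        ε * (2 / β) * ((n : ℝ) / ((k : ℝ) + 1)) ^ β) := by
  wlog hjk : j ≤ k generalizing j k
  · rw [norm_sub_rev, add_right_comm]
    exact this hk hj (le_of_not_ge hjk)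
  have hpow := rpow_sub_one_le (one_le_div_add_one hj) hβ hε hεβ
  have hpow_nonneg : 0 ≤ ε * (2 / β) * ((n : ℝ) / ((k : ℝ) + 1)) ^ β := by positivity
  calc ‖a j - a k‖ ≤ τ * ‖a (n - 1)‖ *
        ((((k : ℝ) + 1) / ((j : ℝ) + 1)) ^ ε + τ * ((n : ℝ) / ((j : ℝ) + 1)) ^ ε) :=
        ho.norm_sub_le_of_le hτ hjk hk
    _ ≤ τ * ‖a (n - 1)‖ *
        (((n : ℝ) / ((j : ℝ) + 1)) ^ ε + τ * ((n : ℝ) / ((j : ℝ) + 1)) ^ ε) := by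
        gcongr
        exact_mod_cast hk
    _ = τ * ‖a (n - 1)‖ * (1 + τ) * ((n : ℝ) / ((j : ℝ) + 1)) ^ ε := by ring
    _ ≤ _ := by gcongr; linarith

theorem succ (ho : OscillationBelow a τ ε n) (hτ : 0 ≤ τ) (hε : 0 ≤ ε)
    (hτγ : τ ≤ γ)
    (hstep : ∀ i < n,
      ‖a n - a i‖ ≤ τ * ‖a (n - 1)‖ * ((n : ℝ) / ((i : ℝ) + 1)) ^ ε * (1 - γ)) :
    OscillationBelow a τ ε (n + 1) := by
  intro k hk j hjk
  obtain hkn | rfl := Nat.lt_succ_iff_lt_or_eq.1 hk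
  · exact ho k hkn j hjk
  obtain hj | rfl := hjk.lt_or_eq
  swap
  · rw [sub_self, norm_zero]
    positivity
  have hk0 : (0 : ℝ) < k := by exact_mod_cast (by omega : 0 < k)
  have hlast : ‖a (k - 1)‖ * (1 - γ) ≤ ‖a k‖ := by
    have hsub := hstep (k - 1) (by omega)
    have hk1 : ((k - 1 : ℕ) : ℝ) + 1 = k := by exact_mod_cast (by omega : k - 1 + 1 = k)
    rw [hk1, div_self hk0.ne', Real.one_rpow, mul_one] at hsub
    have hγ : τ * ‖a (k - 1)‖ * (1 - γ) ≤ τ * ‖a (k - 1)‖ :=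
      mul_le_of_le_one_right (by positivity) (by linarith)
    have hτZ : τ * ‖a (k - 1)‖ ≤ γ * ‖a (k - 1)‖ := by gcongr
    linarith [norm_sub_norm_le (a (k - 1)) (a k), norm_sub_rev (a (k - 1)) (a k)]
  rw [norm_sub_rev]
  calc ‖a k - a j‖ ≤ τ * ‖a (k - 1)‖ * ((k : ℝ) / ((j : ℝ) + 1)) ^ ε * (1 - γ) := hstep j hj
    _ = τ * (‖a (k - 1)‖ * (1 - γ)) * ((k : ℝ) / ((j : ℝ) + 1)) ^ ε := by ring
    _ ≤ τ * ‖a k‖ * (((k : ℝ) + 1) / ((j : ℝ) + 1)) ^ ε := by gcongr; linarith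

end OscillationBelow

theorem norm_le_of_le_two_mul (ho : ∀ n, OscillationBelow a τ ε n) (hτ : τ ≤ 1 / 8) (hε : ε ≤ 1)
    {j k : ℕ} (hkj : k ≤ j) (hj : j + 1 ≤ 2 * (k + 1)) : ‖a j‖ ≤ 4 / 3 * ‖a k‖ := by
  have hr1 : 1 ≤ ((j : ℝ) + 1) / ((k : ℝ) + 1) := by
    rw [one_le_div (by positivity)]
    exact_mod_cast (by omega : k + 1 ≤ j + 1)
  have hr2 : ((j : ℝ) + 1) / ((k : ℝ) + 1) ≤ 2 := by
    rw [div_le_iff₀ (by positivity)]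
    exact_mod_cast hj
  have hpow : (((j : ℝ) + 1) / ((k : ℝ) + 1)) ^ ε ≤ 2 :=
    (Real.rpow_le_self_of_one_le hr1 hε).trans hr2
  have hosc := ho (j + 1) j (by omega) k hkj
  have hle : τ * ‖a j‖ * (((j : ℝ) + 1) / ((k : ℝ) + 1)) ^ ε ≤ 1 / 8 * ‖a j‖ * 2 := by gcongr
  linarith [norm_sub_norm_le (a j) (a k), norm_sub_rev (a j) (a k)]

theorem norm_le_two_mul_div_mul (ho : ∀ n, OscillationBelow a τ ε n) (hτ : τ ≤ 1 / 8)
    (hε : ε ≤ 1) {j : ℕ} (hij : i ≤ j) :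
    ‖a j‖ ≤ 2 * (((j : ℝ) + 1) / ((i : ℝ) + 1)) * ‖a i‖ := by
  induction j using Nat.strong_induction_on with
  | _ j ih =>
    rcases le_or_gt (j + 1) (2 * (i + 1)) with hj | hj
    · have hr : 1 ≤ ((j : ℝ) + 1) / ((i : ℝ) + 1) := by
        rw [one_le_div (by positivity)]
        exact_mod_cast (by omega : i + 1 ≤ j + 1)
      refine (norm_le_of_le_two_mul ho hτ hε hij hj).trans ?_
      gcongr
      linarith
    · have hhalf : 4 / 3 * (((j / 2 : ℕ) : ℝ) + 1) ≤ (j : ℝ) + 1 := by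
        have : (4 : ℝ) * (((j / 2 : ℕ) : ℝ) + 1) ≤ 3 * ((j : ℝ) + 1) := by
          exact_mod_cast (by omega : 4 * (j / 2 + 1) ≤ 3 * (j + 1))
        linarith
      calc ‖a j‖ ≤ 4 / 3 * ‖a (j / 2)‖ := norm_le_of_le_two_mul ho hτ hε (by omega) (by omega)
        _ ≤ 4 / 3 * (2 * ((((j / 2 : ℕ) : ℝ) + 1) / ((i : ℝ) + 1)) * ‖a i‖) := by
          gcongr
          exact ih (j / 2) (by omega) (by omega)
        _ = 2 * ((4 / 3 * (((j / 2 : ℕ) : ℝ) + 1)) / ((i : ℝ) + 1)) * ‖a i‖ := by ring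
        _ ≤ _ := by gcongr

theorem norm_sub_le_rpow_add_sq (ho : ∀ n, OscillationBelow a τ ε n) (hτ0 : 0 ≤ τ)
    (hτ : τ ≤ 1 / 8) (hε : ε ≤ 1) (hεβ : ε ≤ β) (j n : ℕ) :
    ‖a j - a n‖ ≤ 2 * τ * ‖a n‖ *
      ((((n : ℝ) + 1) / ((j : ℝ) + 1)) ^ β + (((j : ℝ) + 1) / ((n : ℝ) + 1)) ^ 2) := by
  rcases le_total j n with hjn | hnj
  · have hr : 1 ≤ ((n : ℝ) + 1) / ((j : ℝ) + 1) := by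
      rw [one_le_div (by positivity)]
      exact_mod_cast (by omega : j + 1 ≤ n + 1)
    calc ‖a j - a n‖ ≤ τ * ‖a n‖ * (((n : ℝ) + 1) / ((j : ℝ) + 1)) ^ ε :=
          ho (n + 1) n (by omega) j hjn
      _ ≤ (2 * τ) * ‖a n‖ * (((n : ℝ) + 1) / ((j : ℝ) + 1)) ^ β := by
          gcongr
          linarith
      _ ≤ _ := by
          gcongr
          exact le_add_of_nonneg_right (by positivity)
  · have hr : 1 ≤ ((j : ℝ) + 1) / ((n : ℝ) + 1) := by
      rw [one_le_div (by positivity)]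
      exact_mod_cast (by omega : n + 1 ≤ j + 1)
    rw [norm_sub_rev]
    calc ‖a n - a j‖ ≤ τ * ‖a j‖ * (((j : ℝ) + 1) / ((n : ℝ) + 1)) ^ ε :=
          ho (j + 1) j (by omega) n hnj
      _ ≤ τ * (2 * (((j : ℝ) + 1) / ((n : ℝ) + 1)) * ‖a n‖) * (((j : ℝ) + 1) / ((n : ℝ) + 1)) := by
          gcongr
          · exact norm_le_two_mul_div_mul ho hτ hε hnj
          · exact Real.rpow_le_self_of_one_le hr hε
      _ = 2 * τ * ‖a n‖ * (((j : ℝ) + 1) / ((n : ℝ) + 1)) ^ 2 := by ring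
      _ ≤ _ := by
          gcongr
          exact le_add_of_nonneg_left (by positivity)

namespace IsPastError

theorem norm_le (hs : IsPastError a s σ ε₀) (ho : OscillationBelow a τ ε n) (hτ : τ ≤ 1)
    (hε : 0 ≤ ε) (hε₀ : ε ≤ ε₀) (hn : 1 ≤ n) : ‖s n‖ ≤ σ * (2 * ‖a (n - 1)‖) :=
  hs n hn _ (by positivity) fun _ hj => ho.norm_le_two_mul hτ hε hε₀ hj

theorem norm_le_of_lt (hs : IsPastError a s σ ε₀) (ho : OscillationBelow a τ ε n) (hσ : 0 ≤ σ)
    (hτ : τ ≤ 1) (hε : 0 ≤ ε) (hε1 : ε ≤ 1) (hε₀ : ε ≤ ε₀) (hi1 : 1 ≤ i) (hi : i < n) :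
    ‖s i‖ ≤ σ * (4 * ‖a (n - 1)‖ * ((n : ℝ) / ((i : ℝ) + 1)) ^ ε) := by
  have hi0 : (1 : ℝ) ≤ i := by exact_mod_cast hi1
  have hpast (j : ℕ) (hj : j < i) :
      ‖a j‖ ≤ 2 * ‖a (n - 1)‖ * ((n : ℝ) / i) ^ ε * ((i : ℝ) / ((j : ℝ) + 1)) ^ ε₀ := by
    refine (ho.norm_le_two_mul hτ hε le_rfl (hj.trans hi)).trans ?_
    rw [← div_mul_div_cancel₀ (b := (i : ℝ)) (by positivity),
      Real.mul_rpow (by positivity) (by positivity), ← mul_assoc]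
    gcongr
    exact one_le_div_add_one hj
  refine (hs i hi1 _ (by positivity) hpast).trans (mul_le_mul_of_nonneg_left ?_ hσ)
  have hpow : ((n : ℝ) / i) ^ ε ≤ 2 * ((n : ℝ) / ((i : ℝ) + 1)) ^ ε :=
    calc ((n : ℝ) / i) ^ ε ≤ (2 * ((n : ℝ) / ((i : ℝ) + 1))) ^ ε := by
          refine Real.rpow_le_rpow (by positivity) ?_ hε
          rw [mul_div_assoc', div_le_div_iff₀ (by positivity) (by positivity)]
          nlinarith [(Nat.cast_nonneg n : (0 : ℝ) ≤ n)]
      _ = 2 ^ ε * ((n : ℝ) / ((i : ℝ) + 1)) ^ ε := Real.mul_rpow (by positivity) (by positivity)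
      _ ≤ _ := by gcongr; exact Real.rpow_le_self_of_one_le one_le_two hε1
  calc 2 * ‖a (n - 1)‖ * ((n : ℝ) / i) ^ ε
      ≤ 2 * ‖a (n - 1)‖ * (2 * ((n : ℝ) / ((i : ℝ) + 1)) ^ ε) := by gcongr
    _ = _ := by ring

end IsPastError

variable [NormedSpace ℝ E]

/-- The sequence `a` is the average of its past under the rows of `w`, up to the error `s`. -/
def IsPastAverage (w : ℕ → ℕ → ℝ) (a s : ℕ → E) : Prop :=
  ∀ n, a n = ∑ j ∈ Finset.range (max n 1), w n j • a j + s n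

namespace IsPastAverage

theorem error_zero (ha : IsPastAverage w a s) (h : HarrisKernel β C c κ w) : s 0 = 0 := by
  have hw : w 0 0 = 1 := by simpa using h.sum_eq_one 0
  simpa [hw] using ha 0

theorem eq_of_le (ha : IsPastAverage w a s) (h : HarrisKernel β C c κ w) {N : ℕ}
    (hN : max n 1 ≤ N) : a n = ∑ j ∈ Finset.range N, w n j • a j + s n := by
  rw [h.sum_smul_eq hN]
  exact ha n

end IsPastAverage

namespace HarrisKernel

theorem norm_sub_le_of_far (h : HarrisKernel β C c κ w) (ha : IsPastAverage w a s)
    (ho : OscillationBelow a τ ε n) (hτ : 0 ≤ τ) (hβ : 0 < β) (hε : 0 ≤ ε) (hε1 : ε ≤ 1)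
    (hεβ : ε ≤ β / 4) (hi : i < n) (hn : 2 ≤ n) :
    ‖a n - a i‖ ≤ τ * ‖a (n - 1)‖ * ((n : ℝ) / ((i : ℝ) + 1)) ^ ε *
      (1 - ε * c + ε * (4 / β) * C / ((n : ℝ) / ((i : ℝ) + 1)) ^ β + τ * (1 + C)) + ‖s n‖ := by
  have hmass := h.sum_eq_one_of_le (n := n) (N := n) (by omega)
  have hmoment := h.moment_self (n := n) (by omega)
  have hdrift := h.drift n hn
  have hsub : a n - a i = ∑ j ∈ Finset.range n, w n j • (a j - a i) + s n := by
    simp only [smul_sub, Finset.sum_sub_distrib, ← Finset.sum_smul, hmass, one_smul]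
    rw [sub_add_eq_add_sub, ← ha.eq_of_le h (by omega)]
  set r := (n : ℝ) / ((i : ℝ) + 1)
  set T := τ * ‖a (n - 1)‖ * r ^ ε
  have hterm (j : ℕ) (hj : j ∈ Finset.range n) : ‖w n j • (a j - a i)‖ ≤
      w n j * (T * (1 + ε * (((j : ℝ) + 1) / n - 1) +
        ε * (4 / β) * ((n : ℝ) / ((j : ℝ) + 1)) ^ β / r ^ β +
        τ * (1 + ((n : ℝ) / ((j : ℝ) + 1)) ^ β))) := by
    rw [norm_smul, Real.norm_of_nonneg (h.nonneg n j)]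
    exact mul_le_mul_of_nonneg_left
      (ho.norm_sub_le_mul_moment hτ hβ hε hε1 hεβ hi (Finset.mem_range.1 hj)) (h.nonneg n j)
  rw [hsub]
  refine (norm_add_le_of_le (norm_sum_le_of_le _ hterm) le_rfl).trans ?_
  gcongr
  calc _ = T * ((1 - ε + τ) * ∑ j ∈ Finset.range n, w n j +
          ε * ∑ j ∈ Finset.range n, w n j * (((j : ℝ) + 1) / n) +
          (ε * (4 / β) / r ^ β + τ) *
            ∑ j ∈ Finset.range n, w n j * ((n : ℝ) / ((j : ℝ) + 1)) ^ β) := by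
        simp only [Finset.mul_sum, ← Finset.sum_add_distrib]
        exact Finset.sum_congr rfl fun j _ => by ring
    _ ≤ T * ((1 - ε + τ) * 1 + ε * (1 - c) + (ε * (4 / β) / r ^ β + τ) * C) := by
        rw [hmass]
        gcongr
    _ = _ := by ring

theorem norm_sub_le_of_near (h : HarrisKernel β C c κ w) (ha : IsPastAverage w a s)
    (ho : OscillationBelow a τ ε n) (hτ : 0 ≤ τ) (hβ : 0 < β) (hβ1 : β ≤ 1) (hε : 0 ≤ ε)
    (hεβ : ε ≤ β / 2) (hR : 1 ≤ R) (hi : i < n) (hiR : (n : ℝ) ≤ R * ((i : ℝ) + 1)) :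
    ‖a n - a i‖ ≤ τ * ‖a (n - 1)‖ * (1 + τ) * (1 - κ R + ε * (2 / β) * (1 + 2 * R) * C) +
      ‖s n‖ + ‖s i‖ := by
  obtain ⟨v, hv, hκ⟩ := h.overlap R i n hi hiR
  set e : ℕ → ℝ := fun j => ε * (2 / β) * ((n : ℝ) / ((j : ℝ) + 1)) ^ β
  have hmoment {m : ℕ} {C' : ℝ}
      (hm : ∑ j ∈ Finset.range n, w m j * ((n : ℝ) / ((j : ℝ) + 1)) ^ β ≤ C') :
      ∑ j ∈ Finset.range n, w m j * e j ≤ ε * (2 / β) * C' := by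
    refine le_trans (le_of_eq ?_) (mul_le_mul_of_nonneg_left hm (by positivity))
    rw [Finset.mul_sum]
    exact Finset.sum_congr rfl fun j _ => mul_left_comm _ _ _
  have hcoupling := norm_sum_smul_sub_sum_smul_le_of_overlap (a := a) (e := e)
    (T := τ * ‖a (n - 1)‖ * (1 + τ)) (by positivity)
    (fun j _ => by positivity) (fun j _ => (hv j).1) (fun j _ => (hv j).2.1)
    (fun j _ => (hv j).2.2) (h.sum_eq_one_of_le (by omega)) (h.sum_eq_one_of_le (by omega))
    fun j hj k hk => ho.norm_sub_le_add_moment hτ hβ hε hεβ (Finset.mem_range.1 hj)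
      (Finset.mem_range.1 hk)
  rw [ha.eq_of_le h (n := n) (N := n) (by omega), ha.eq_of_le h (n := i) (N := n) (by omega),
    add_sub_add_comm]
  refine (norm_add_le_of_le hcoupling (norm_sub_le _ _)).trans ?_
  rw [← add_assoc]
  gcongr _ * ?_ + _ + _
  linarith [hmoment (h.moment_self (n := n) (by omega)),
    hmoment (h.moment_of_lt hβ.le hβ1 hR hi hiR)]

end HarrisKernel

theorem exists_contraction_scale (hβ : 0 < β) (hC : 0 ≤ C) (hc : 0 < c)
    (hκ : ∀ R, 1 ≤ R → 0 < κ R) (hε₀ : 0 < ε₀) :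
    ∃ R ε γ : ℝ, 1 ≤ R ∧ 0 < ε ∧ ε ≤ ε₀ ∧ ε ≤ 1 ∧ ε ≤ β / 4 ∧ 0 < γ ∧ γ ≤ 1 / 2 ∧
      γ ≤ κ R - ε * (2 / β) * (1 + 2 * R) * C ∧
      ∀ r, R ≤ r → γ ≤ ε * c - ε * (4 / β) * C / r ^ β := by
  set R := max 1 ((8 * C / (β * c)) ^ (1 / β))
  have hR : 1 ≤ R := le_max_left _ _
  have hκR := hκ R hR
  have hK : 0 < (2 / β) * (1 + 2 * R) * (C + 1) := by positivity
  set ε := min (min ε₀ 1) (min (β / 4) (κ R / 2 / ((2 / β) * (1 + 2 * R) * (C + 1))))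
  have hε : 0 < ε := by positivity
  have hnear : ε * (2 / β) * (1 + 2 * R) * C ≤ κ R / 2 :=
    calc ε * (2 / β) * (1 + 2 * R) * C ≤ ε * ((2 / β) * (1 + 2 * R) * (C + 1)) := by
          rw [mul_assoc, mul_assoc, ← mul_assoc (2 / β)]
          gcongr
          linarith
      _ ≤ κ R / 2 := (le_div_iff₀ hK).1 ((min_le_right _ _).trans (min_le_right _ _))
  have hfar (r : ℝ) (hr : R ≤ r) : ε * (4 / β) * C / r ^ β ≤ ε * c / 2 := by
    have hr0 : 0 < r := by linarith
    have hpow : 8 * C / (β * c) ≤ r ^ β := by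
      have hroot : (8 * C / (β * c)) ^ (1 / β) ≤ r := (le_max_right _ _).trans hr
      calc 8 * C / (β * c) = ((8 * C / (β * c)) ^ (1 / β)) ^ β := by
            rw [← Real.rpow_mul (by positivity), one_div_mul_cancel hβ.ne', Real.rpow_one]
        _ ≤ r ^ β := Real.rpow_le_rpow (by positivity) hroot hβ.le
    rw [div_le_iff₀ (by positivity)]
    calc ε * (4 / β) * C = ε * c / 2 * (8 * C / (β * c)) := by field_simp; ring
      _ ≤ ε * c / 2 * r ^ β := by gcongr
  refine ⟨R, ε, min (1 / 2) (min (κ R / 2) (ε * c / 2)), hR, hε,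
    (min_le_left _ _).trans (min_le_left _ _), (min_le_left _ _).trans (min_le_right _ _),
    (min_le_right _ _).trans (min_le_left _ _), by positivity, min_le_left _ _, ?_, fun r hr => ?_⟩
  · linarith [(min_le_right (1 / 2) (min (κ R / 2) (ε * c / 2))).trans (min_le_left _ _)]
  · linarith [(min_le_right (1 / 2) (min (κ R / 2) (ε * c / 2))).trans (min_le_right _ _),
      hfar r hr]

namespace HarrisKernel

theorem norm_sub_le_of_gap (h : HarrisKernel β C c κ w) (ha : IsPastAverage w a s)
    (ho : OscillationBelow a τ ε n) (hτ : 0 ≤ τ) (hβ : 0 < β) (hβ1 : β ≤ 1) (hε : 0 ≤ ε)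
    (hε1 : ε ≤ 1) (hεβ : ε ≤ β / 4) (hR : 1 ≤ R) (hγ0 : 0 ≤ γ) (hγ : γ ≤ 1)
    (hnear : γ ≤ κ R - ε * (2 / β) * (1 + 2 * R) * C)
    (hfar : ∀ r, R ≤ r → γ ≤ ε * c - ε * (4 / β) * C / r ^ β) (hi : i < n) :
    ‖a n - a i‖ ≤ τ * ‖a (n - 1)‖ * ((n : ℝ) / ((i : ℝ) + 1)) ^ ε * (1 - γ + τ * (1 + C)) +
      ‖s n‖ + ‖s i‖ := by
  have hC := h.moment_nonneg
  have hr : 1 ≤ ((n : ℝ) / ((i : ℝ) + 1)) ^ ε := Real.one_le_rpow (one_le_div_add_one hi) hε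
  rcases le_or_gt (n : ℝ) (R * ((i : ℝ) + 1)) with hiR | hiR
  · refine (h.norm_sub_le_of_near ha ho hτ hβ hβ1 hε (by linarith) hR hi hiR).trans ?_
    gcongr ?_ + _ + _
    calc _ ≤ τ * ‖a (n - 1)‖ * (1 + τ) * (1 - γ) := by gcongr; linarith
      _ ≤ τ * ‖a (n - 1)‖ * (1 - γ + τ * (1 + C)) := by
        rw [mul_assoc]
        gcongr
        nlinarith [mul_nonneg hτ hγ0, mul_nonneg hτ hC]
      _ ≤ _ := mul_le_mul_of_nonneg_right (le_mul_of_one_le_right (by positivity) hr)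
        (add_nonneg (by linarith) (by positivity))
  · have hn : 2 ≤ n := by
      have hi1 : (1 : ℝ) * ((i : ℝ) + 1) < n := (by gcongr : _ ≤ R * ((i : ℝ) + 1)).trans_lt hiR
      have : i + 1 < n := by exact_mod_cast (one_mul ((i : ℝ) + 1)).symm.trans_lt hi1
      omega
    refine (h.norm_sub_le_of_far ha ho hτ hβ hε hε1 hεβ hi hn).trans
      (le_add_of_le_of_nonneg ?_ (norm_nonneg _))
    gcongr
    linarith [hfar _ ((le_div_iff₀ (by positivity)).2 hiR.le)]

end HarrisKernel

theorem IsPastError.norm_add_norm_le (hs : IsPastError a s σ ε₀) (ho : OscillationBelow a τ ε n)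
    (h : HarrisKernel β C c κ w) (ha : IsPastAverage w a s) (hσ : 0 ≤ σ)
    (hτ : τ ≤ 1) (hε : 0 ≤ ε) (hε1 : ε ≤ 1) (hε₀ : ε ≤ ε₀) (hi : i < n) :
    ‖s n‖ + ‖s i‖ ≤ 6 * σ * ‖a (n - 1)‖ * ((n : ℝ) / ((i : ℝ) + 1)) ^ ε := by
  have hr : 1 ≤ ((n : ℝ) / ((i : ℝ) + 1)) ^ ε := Real.one_le_rpow (one_le_div_add_one hi) hε
  have hsn : ‖s n‖ ≤ σ * (2 * ‖a (n - 1)‖ * ((n : ℝ) / ((i : ℝ) + 1)) ^ ε) :=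
    (hs.norm_le ho hτ hε hε₀ (by omega)).trans
      (mul_le_mul_of_nonneg_left (le_mul_of_one_le_right (by positivity) hr) hσ)
  have hsi : ‖s i‖ ≤ σ * (4 * ‖a (n - 1)‖ * ((n : ℝ) / ((i : ℝ) + 1)) ^ ε) := by
    rcases Nat.eq_zero_or_pos i with rfl | hi1
    · rw [ha.error_zero h, norm_zero]
      positivity
    · exact hs.norm_le_of_lt ho hσ hτ hε hε1 hε₀ hi1 hi
  linarith

theorem exists_oscillation_bound (hβ : 0 < β) (hβ1 : β ≤ 1) (hC : 0 ≤ C) (hc : 0 < c)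
    (hκ : ∀ R, 1 ≤ R → 0 < κ R) (hε₀ : 0 < ε₀) :
    ∃ ε B δ : ℝ, 0 < ε ∧ ε ≤ ε₀ ∧ ε ≤ 1 ∧ ε ≤ β ∧ 0 < B ∧ 0 < δ ∧ B * δ ≤ 1 / 8 ∧
      ∀ (E : Type*) [NormedAddCommGroup E] [NormedSpace ℝ E] (w : ℕ → ℕ → ℝ) (a s : ℕ → E)
        (σ : ℝ), 0 ≤ σ → σ ≤ δ → HarrisKernel β C c κ w → IsPastAverage w a s →
        IsPastError a s σ ε₀ → ∀ n, OscillationBelow a (B * σ) ε n := by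
  obtain ⟨R, ε, γ, hR, hε, hεε₀, hε1, hεβ, hγ, hγ2, hnear, hfar⟩ :=
    exists_contraction_scale hβ hC hc hκ hε₀
  have hBδ : 24 / γ * (γ ^ 2 / (96 * (1 + C))) * (1 + C) = γ / 4 := by field_simp; norm_num
  have hBδ_le : 24 / γ * (γ ^ 2 / (96 * (1 + C))) ≤ γ / 4 :=
    hBδ ▸ le_mul_of_one_le_right (by positivity) (by linarith)
  refine ⟨ε, 24 / γ, γ ^ 2 / (96 * (1 + C)), hε, hεε₀, hε1, by linarith, by positivity,
    by positivity, by linarith, fun E _ _ w a s σ hσ hσδ h ha hs n => ?_⟩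
  set τ := 24 / γ * σ with hτ_def
  have hτ : 0 ≤ τ := by positivity
  have hτδ : τ ≤ 24 / γ * (γ ^ 2 / (96 * (1 + C))) := mul_le_mul_of_nonneg_left hσδ (by positivity)
  have hτC : τ * (1 + C) ≤ γ / 4 := hBδ ▸ mul_le_mul_of_nonneg_right hτδ (by linarith)
  have : τ ≤ γ / 4 := hτδ.trans hBδ_le
  have hσ_eq : 6 * σ = τ * (γ / 4) := by rw [hτ_def]; field_simp; ring
  induction n with
  | zero => exact fun i hi => absurd hi (Nat.not_lt_zero i)
  | succ n ho =>
    refine ho.succ hτ hε.le (γ := γ / 2) (by linarith) fun i hi => ?_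
    have hgap := h.norm_sub_le_of_gap ha ho hτ hβ hβ1 hε.le hε1 hεβ hR hγ.le (by linarith)
      hnear hfar hi
    have herr := hs.norm_add_norm_le ho h ha hσ (by linarith) hε.le hε1 hεε₀ hi
    rw [hσ_eq] at herr
    calc ‖a n - a i‖ ≤ τ * ‖a (n - 1)‖ * ((n : ℝ) / ((i : ℝ) + 1)) ^ ε *
          (1 - γ + τ * (1 + C) + γ / 4) := by linarith
      _ ≤ _ := by gcongr; linarith

end Harris

section PowerSums

theorem sum_rpow_neg_le (n : ℕ) {θ : ℝ} (h0 : 0 ≤ θ) (h1 : θ < 1) :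
    ∑ j ∈ Finset.range n, ((j : ℝ) + 1) ^ (-θ) ≤ (n : ℝ) ^ (1 - θ) / (1 - θ) := by
  have hθ : 0 < 1 - θ := by linarith
  induction n with
  | zero => simp [Real.zero_rpow hθ.ne']
  | succ n ih =>
    have hn : (0 : ℝ) < (n : ℝ) + 1 := by positivity
    have hbernoulli : (n : ℝ) ^ (1 - θ) ≤
        (1 + (1 - θ) * (-1 / ((n : ℝ) + 1))) * ((n : ℝ) + 1) ^ (1 - θ) := by
      have h := rpow_one_add_le_one_add_mul_self (s := -1 / ((n : ℝ) + 1)) (p := 1 - θ)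
        (by rw [neg_div, neg_le_neg_iff, div_le_one hn]; linarith [n.cast_nonneg (α := ℝ)])
        hθ.le (by linarith)
      rwa [show 1 + -1 / ((n : ℝ) + 1) = n / (n + 1) by field_simp; ring,
        Real.div_rpow (by positivity) hn.le, div_le_iff₀ (by positivity)] at h
    have hlast : ((n : ℝ) + 1) ^ (-θ) = ((n : ℝ) + 1) ^ (1 - θ) / (n + 1) := by
      rw [Real.rpow_sub hn, Real.rpow_neg hn.le, Real.rpow_one]
      field_simp
    rw [Finset.sum_range_succ, hlast]
    push_cast
    calc ∑ j ∈ Finset.range n, ((j : ℝ) + 1) ^ (-θ) + ((n : ℝ) + 1) ^ (1 - θ) / (n + 1)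
        ≤ ((1 + (1 - θ) * (-1 / ((n : ℝ) + 1))) * ((n : ℝ) + 1) ^ (1 - θ)) / (1 - θ)
          + ((n : ℝ) + 1) ^ (1 - θ) / (n + 1) := by
          gcongr
          exact ih.trans (by gcongr)
      _ = ((n : ℝ) + 1) ^ (1 - θ) / (1 - θ) := by field_simp; ring

theorem sum_rpow_div_le (n : ℕ) {θ : ℝ} (h0 : 0 ≤ θ) (h1 : θ < 1) :
    ∑ j ∈ Finset.range n, ((n : ℝ) / ((j : ℝ) + 1)) ^ θ ≤ n / (1 - θ) := by
  rcases Nat.eq_zero_or_pos n with rfl | hn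
  · simp
  have hn' : (0 : ℝ) < n := by exact_mod_cast hn
  calc ∑ j ∈ Finset.range n, ((n : ℝ) / ((j : ℝ) + 1)) ^ θ
      = (n : ℝ) ^ θ * ∑ j ∈ Finset.range n, ((j : ℝ) + 1) ^ (-θ) := by
        rw [Finset.mul_sum]
        refine Finset.sum_congr rfl fun j _ => ?_
        rw [Real.div_rpow hn'.le (by positivity), Real.rpow_neg (by positivity), div_eq_mul_inv]
    _ ≤ (n : ℝ) ^ θ * ((n : ℝ) ^ (1 - θ) / (1 - θ)) := by
        gcongr
        exact sum_rpow_neg_le n h0 h1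
    _ = n / (1 - θ) := by
        rw [← mul_div_assoc, ← Real.rpow_add hn', add_sub_cancel, Real.rpow_one]

theorem sum_mul_rpow_div_le {p p' θ ρ : ℝ} (hp : p.HolderConjugate p') (hθ : 0 ≤ θ)
    (hθ1 : θ * p' < 1) (hρ : 0 ≤ ρ) {g : ℕ → ℝ} (hg : ∀ j, 0 ≤ g j) {n : ℕ}
    (hgρ : ∑ j ∈ Finset.range n, g j ^ p ≤ n * ρ ^ p) :
    ∑ j ∈ Finset.range n, g j * ((n : ℝ) / ((j : ℝ) + 1)) ^ θ ≤
      n * ((1 / (1 - θ * p')) ^ (1 / p') * ρ) := by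
  have hp' := hp.symm.pos
  have : 0 < 1 - θ * p' := by linarith
  rcases Nat.eq_zero_or_pos n with rfl | hn
  · simp
  have hn' : (0 : ℝ) < n := by exact_mod_cast hn
  have hpow : ∑ j ∈ Finset.range n, (((n : ℝ) / ((j : ℝ) + 1)) ^ θ) ^ p' ≤
      n * (1 / (1 - θ * p')) := by
    rw [mul_one_div]
    refine le_trans (le_of_eq ?_) (sum_rpow_div_le n (mul_nonneg hθ hp'.le) hθ1)
    exact Finset.sum_congr rfl fun j _ => (Real.rpow_mul (by positivity) _ _).symm
  have hsplit : (n : ℝ) ^ (1 / p) * (n : ℝ) ^ (1 / p') = n := by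
    rw [← Real.rpow_add hn', one_div, one_div, hp.inv_add_inv_eq_one, Real.rpow_one]
  calc ∑ j ∈ Finset.range n, g j * ((n : ℝ) / ((j : ℝ) + 1)) ^ θ
      ≤ (∑ j ∈ Finset.range n, g j ^ p) ^ (1 / p) *
          (∑ j ∈ Finset.range n, (((n : ℝ) / ((j : ℝ) + 1)) ^ θ) ^ p') ^ (1 / p') :=
        Real.inner_le_Lp_mul_Lq_of_nonneg _ hp (fun j _ => hg j) fun j _ => by positivity
    _ ≤ (n * ρ ^ p) ^ (1 / p) * (n * (1 / (1 - θ * p'))) ^ (1 / p') := by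
        have hpos := hp.pos
        gcongr
        exact Finset.sum_nonneg fun j _ => Real.rpow_nonneg (hg j) p
    _ = (n : ℝ) ^ (1 / p) * (n : ℝ) ^ (1 / p') * ((1 / (1 - θ * p')) ^ (1 / p') * ρ) := by
        rw [Real.mul_rpow hn'.le (by positivity), Real.mul_rpow hn'.le (by positivity),
          ← Real.rpow_mul hρ, mul_one_div_cancel hp.pos.ne', Real.rpow_one]
        ring
    _ = _ := by rw [hsplit]

end PowerSums

/-- The recurrence `n q_n = ∑_{j < n} D_{n-j} q_j` of the coefficients of
`exp {∑_{j ≥ 1} (D_j / j) z^j}`, for real multipliers between `d` and `A`. -/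
structure PositiveRecurrence (d A : ℝ) (D q : ℕ → ℝ) : Prop where
  d_pos : 0 < d
  d_le_one : d ≤ 1
  one_le_A : 1 ≤ A
  lower : ∀ j, 1 ≤ j → d ≤ D j
  upper : ∀ j, 1 ≤ j → D j ≤ A
  zero : q 0 = 1
  mul_eq : ∀ n : ℕ, (n : ℝ) * q n = ∑ j ∈ Finset.range n, D (n - j) * q j

/-- The sum `q 0 + ⋯ + q (n - 1)`. -/
def partialSum (q : ℕ → ℝ) (n : ℕ) : ℝ := ∑ j ∈ Finset.range n, q j

/-- The share of the term of index `j` in the recurrence for `n q_n`; row `0` is the unit mass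
at `0`. -/
noncomputable def weight (D q : ℕ → ℝ) (n j : ℕ) : ℝ :=
  if n = 0 then (if j = 0 then 1 else 0)
  else if j < n then D (n - j) * q j / (n * q n) else 0

section Recurrence

variable {d A : ℝ} {D q : ℕ → ℝ} {m n j : ℕ}

theorem partialSum_succ (q : ℕ → ℝ) (n : ℕ) :
    partialSum q (n + 1) = partialSum q n + q n := Finset.sum_range_succ _ _

theorem weight_of_lt (hj : j < n) : weight D q n j = D (n - j) * q j / (n * q n) := by
  simp [weight, hj, Nat.ne_zero_of_lt hj]

theorem weight_eq_zero (hj : max n 1 ≤ j) : weight D q n j = 0 := by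
  rw [weight, if_neg (by omega : ¬j = 0), if_neg (by omega : ¬j < n), ite_self]

namespace PositiveRecurrence

theorem A_pos (h : PositiveRecurrence d A D q) : 0 < A := one_pos.trans_le h.one_le_A

theorem pos (h : PositiveRecurrence d A D q) (n : ℕ) : 0 < q n := by
  induction n using Nat.strong_induction_on with
  | _ n ih =>
    rcases Nat.eq_zero_or_pos n with rfl | hn
    · rw [h.zero]
      exact one_pos
    have hsum : 0 < ∑ j ∈ Finset.range n, D (n - j) * q j := by
      refine Finset.sum_pos (fun j hj => ?_) ⟨0, Finset.mem_range.2 hn⟩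
      have hj := Finset.mem_range.1 hj
      exact mul_pos (h.d_pos.trans_le (h.lower _ (by omega))) (ih j hj)
    rw [← h.mul_eq] at hsum
    exact (pos_iff_pos_of_mul_pos hsum).1 (by exact_mod_cast hn)

theorem partialSum_pos (h : PositiveRecurrence d A D q) (hn : 1 ≤ n) : 0 < partialSum q n :=
  Finset.sum_pos (fun j _ => h.pos j) ⟨0, Finset.mem_range.2 hn⟩

theorem partialSum_mono (h : PositiveRecurrence d A D q) : Monotone (partialSum q) :=
  monotone_nat_of_le_succ fun n => by rw [partialSum_succ]; linarith [h.pos n]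

theorem mul_partialSum_le (h : PositiveRecurrence d A D q) (n : ℕ) :
    d * partialSum q n ≤ n * q n := by
  rw [h.mul_eq, partialSum, Finset.mul_sum]
  refine Finset.sum_le_sum fun j hj => ?_
  have := Finset.mem_range.1 hj
  exact mul_le_mul_of_nonneg_right (h.lower _ (by omega)) (h.pos j).le

theorem mul_le_partialSum (h : PositiveRecurrence d A D q) (n : ℕ) :
    n * q n ≤ A * partialSum q n := by
  rw [h.mul_eq, partialSum, Finset.mul_sum]
  refine Finset.sum_le_sum fun j hj => ?_
  have := Finset.mem_range.1 hj
  exact mul_le_mul_of_nonneg_right (h.upper _ (by omega)) (h.pos j).le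

theorem partialSum_mul_rpow_le (h : PositiveRecurrence d A D q) (hm : 1 ≤ m) (hmn : m ≤ n) :
    partialSum q m * ((n : ℝ) / m) ^ d ≤ partialSum q n := by
  have hm' : (0 : ℝ) < m := by exact_mod_cast hm
  induction n, hmn using Nat.le_induction with
  | base => simp [hm'.ne']
  | succ n hn ih =>
    have hn' : (0 : ℝ) < n := by exact_mod_cast hm.trans hn
    have hbernoulli : (1 + 1 / (n : ℝ)) ^ d ≤ 1 + d * (1 / n) :=
      rpow_one_add_le_one_add_mul_self (by linarith [one_div_pos.2 hn']) h.d_pos.le h.d_le_one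
    have hratio : ((n + 1 : ℕ) : ℝ) / m = (n / m) * (1 + 1 / n) := by
      push_cast
      field_simp
    rw [hratio, Real.mul_rpow (by positivity) (by positivity), partialSum_succ, ← mul_assoc]
    have hle := h.mul_partialSum_le n
    calc partialSum q m * ((n : ℝ) / m) ^ d * (1 + 1 / (n : ℝ)) ^ d
        ≤ partialSum q n * (1 + d * (1 / n)) :=
          mul_le_mul ih hbernoulli (by positivity) (h.partialSum_pos (hm.trans hn)).le
      _ = partialSum q n + (d * partialSum q n) / n := by field_simp
      _ ≤ partialSum q n + (n * q n) / n := by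
          gcongr
      _ = _ := by field_simp

theorem partialSum_le_mul_rpow (h : PositiveRecurrence d A D q) (hm : 1 ≤ m) (hmn : m ≤ n) :
    partialSum q n ≤ partialSum q m * ((n : ℝ) / m) ^ A := by
  have hm' : (0 : ℝ) < m := by exact_mod_cast hm
  have hA := h.A_pos
  have hQ := h.partialSum_pos hm
  induction n, hmn using Nat.le_induction with
  | base => simp [hm'.ne']
  | succ n hn ih =>
    have hn' : (0 : ℝ) < n := by exact_mod_cast hm.trans hn
    have hbernoulli : 1 + A * (1 / n) ≤ (1 + 1 / (n : ℝ)) ^ A :=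
      one_add_mul_self_le_rpow_one_add (by linarith [one_div_pos.2 hn']) h.one_le_A
    have hratio : ((n + 1 : ℕ) : ℝ) / m = (n / m) * (1 + 1 / n) := by
      push_cast
      field_simp
    rw [hratio, Real.mul_rpow (by positivity) (by positivity), partialSum_succ, ← mul_assoc]
    have hle := h.mul_le_partialSum n
    calc partialSum q n + q n = partialSum q n + (n * q n) / n := by field_simp
      _ ≤ partialSum q n + (A * partialSum q n) / n := by
          gcongr
      _ = partialSum q n * (1 + A * (1 / n)) := by field_simp
      _ ≤ partialSum q m * ((n : ℝ) / m) ^ A * (1 + 1 / (n : ℝ)) ^ A :=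
          mul_le_mul ih hbernoulli (by positivity) (by positivity)

theorem le_partialSum_div (h : PositiveRecurrence d A D q) (j : ℕ) :
    q j ≤ 2 * A * partialSum q (j + 1) / ((j : ℝ) + 1) := by
  have hQ : 0 ≤ partialSum q j := Finset.sum_nonneg fun i _ => (h.pos i).le
  rw [le_div_iff₀ (by positivity), partialSum_succ]
  nlinarith [h.mul_le_partialSum j, mul_le_mul_of_nonneg_right h.one_le_A (h.pos j).le,
    mul_nonneg h.A_pos.le hQ, mul_nonneg h.A_pos.le (h.pos j).le]

theorem weight_nonneg (h : PositiveRecurrence d A D q) (n j : ℕ) : 0 ≤ weight D q n j := by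
  unfold weight
  split_ifs with h1 h2 h3
  · exact zero_le_one
  · exact le_rfl
  · have hD : 0 ≤ D (n - j) := h.d_pos.le.trans (h.lower _ (by omega))
    have := h.pos j
    have := h.pos n
    positivity
  · exact le_rfl

theorem sum_weight (h : PositiveRecurrence d A D q) (n : ℕ) :
    ∑ j ∈ Finset.range (max n 1), weight D q n j = 1 := by
  rcases Nat.eq_zero_or_pos n with rfl | hn
  · simp [weight]
  have hq := h.pos n
  have : (0 : ℝ) < n := by exact_mod_cast hn
  rw [max_eq_left hn, Finset.sum_congr rfl fun j hj => weight_of_lt (Finset.mem_range.1 hj),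
    ← Finset.sum_div, ← h.mul_eq, div_self (by positivity)]

theorem weight_le (h : PositiveRecurrence d A D q) (hj : j < n) :
    weight D q n j ≤ 2 * A ^ 2 / d * (1 / n) * ((n : ℝ) / ((j : ℝ) + 1)) ^ (1 - d) := by
  have hn' : (0 : ℝ) < n := by exact_mod_cast j.zero_le.trans_lt hj
  have hd := h.d_pos
  have hA := h.A_pos
  have hq := h.pos j
  have hQ := h.partialSum_pos (n := n) (by omega)
  have hle := h.mul_partialSum_le n
  have hy : 0 < (n : ℝ) / ((j : ℝ) + 1) := by positivity
  have hQj : partialSum q (j + 1) ≤ partialSum q n / ((n : ℝ) / ((j : ℝ) + 1)) ^ d := by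
    have hgrowth := h.partialSum_mul_rpow_le (m := j + 1) (n := n) (by omega) (by omega)
    push_cast at hgrowth
    exact (le_div_iff₀ (by positivity)).2 hgrowth
  rw [weight_of_lt hj]
  calc D (n - j) * q j / (n * q n)
      ≤ A * (2 * A * (partialSum q n / ((n : ℝ) / ((j : ℝ) + 1)) ^ d) / ((j : ℝ) + 1))
          / (d * partialSum q n) := by
        gcongr
        · exact h.upper _ (by omega)
        · exact (h.le_partialSum_div j).trans (by gcongr)
    _ = 2 * A ^ 2 / d * (1 / n) * ((n : ℝ) / ((j : ℝ) + 1)) ^ (1 - d) := by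
        rw [Real.rpow_sub hy, Real.rpow_one]
        field_simp

theorem le_weight (h : PositiveRecurrence d A D q) (hj : j < n) :
    d / A * (q j / partialSum q n) ≤ weight D q n j := by
  have hn' : (0 : ℝ) < n := by exact_mod_cast j.zero_le.trans_lt hj
  have hd := h.d_pos
  have hA := h.A_pos
  have hQ := h.partialSum_pos (n := n) (by omega)
  have hq := h.pos j
  have hqn := h.pos n
  have hle := h.mul_le_partialSum n
  have hD : d ≤ D (n - j) := h.lower (n - j) (by omega)
  rw [weight_of_lt hj]
  calc d / A * (q j / partialSum q n) = d * q j / (A * partialSum q n) := by field_simp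
    _ ≤ D (n - j) * q j / (n * q n) := by
      have : 0 ≤ D (n - j) := hd.le.trans hD
      gcongr

theorem sum_weight_rpow_le (h : PositiveRecurrence d A D q) (n : ℕ) :
    ∑ j ∈ Finset.range n, weight D q n j * ((n : ℝ) / ((j : ℝ) + 1)) ^ (d / 2) ≤
      4 * A ^ 2 / d ^ 2 := by
  have hd := h.d_pos
  have hd1 := h.d_le_one
  have hA := h.A_pos
  rcases Nat.eq_zero_or_pos n with rfl | hn
  · rw [Finset.sum_range_zero]
    positivity
  have : (0 : ℝ) < n := by exact_mod_cast hn
  calc ∑ j ∈ Finset.range n, weight D q n j * ((n : ℝ) / ((j : ℝ) + 1)) ^ (d / 2)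
      ≤ ∑ j ∈ Finset.range n, 2 * A ^ 2 / d * (1 / n) *
          ((n : ℝ) / ((j : ℝ) + 1)) ^ (1 - d / 2) := by
        refine Finset.sum_le_sum fun j hj => ?_
        have hy : 0 < (n : ℝ) / ((j : ℝ) + 1) := by positivity
        rw [show 1 - d / 2 = (1 - d) + d / 2 by ring, Real.rpow_add hy, ← mul_assoc]
        gcongr
        exact h.weight_le (Finset.mem_range.1 hj)
    _ ≤ 2 * A ^ 2 / d * (1 / n) * (n / (1 - (1 - d / 2))) := by
        rw [← Finset.mul_sum]
        gcongr
        exact sum_rpow_div_le n (by linarith) (by linarith)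
    _ = 4 * A ^ 2 / d ^ 2 := by
        rw [sub_sub_cancel]
        field_simp
        norm_num

theorem one_third_rpow_le_partialSum_half (h : PositiveRecurrence d A D q) (hn : 2 ≤ n) :
    (1 / 3 : ℝ) ^ A ≤ partialSum q (n / 2) / partialSum q n := by
  have hm : 1 ≤ n / 2 := by omega
  have hm' : (0 : ℝ) < (n / 2 : ℕ) := by exact_mod_cast hm
  have hratio : (n : ℝ) / (n / 2 : ℕ) ≤ 3 := by
    rw [div_le_iff₀ hm']
    exact_mod_cast (by omega : n ≤ 3 * (n / 2))
  have hQm := h.partialSum_pos hm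
  have hA := h.A_pos
  rw [le_div_iff₀ (h.partialSum_pos (by omega)), Real.div_rpow zero_le_one zero_le_three,
    Real.one_rpow, div_mul_eq_mul_div, one_mul, div_le_iff₀ (by positivity)]
  exact (h.partialSum_le_mul_rpow hm (by omega)).trans (by gcongr)

theorem sum_weight_mul_div_le (h : PositiveRecurrence d A D q) (hn : 2 ≤ n) :
    ∑ j ∈ Finset.range n, weight D q n j * (((j : ℝ) + 1) / n) ≤
      1 - d / A * (1 / 2) * (1 / 3) ^ A := by
  have hd := h.d_pos
  have hA := h.A_pos
  have hn' : (0 : ℝ) < n := by positivity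
  have hmain : d / A * (1 / 2) * (1 / 3) ^ A ≤
      ∑ j ∈ Finset.range n, weight D q n j * (1 - ((j : ℝ) + 1) / n) :=
    calc d / A * (1 / 2) * (1 / 3) ^ A
        ≤ d / A * (1 / 2) * (partialSum q (n / 2) / partialSum q n) := by
          gcongr
          exact h.one_third_rpow_le_partialSum_half hn
      _ = ∑ j ∈ Finset.range (n / 2), d / A * (q j / partialSum q n) * (1 / 2) := by
          simp only [partialSum, Finset.sum_div, Finset.mul_sum]
          exact Finset.sum_congr rfl fun j _ => by ring
      _ ≤ ∑ j ∈ Finset.range (n / 2), weight D q n j * (1 - ((j : ℝ) + 1) / n) := by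
          refine Finset.sum_le_sum fun j hj => ?_
          have hj := Finset.mem_range.1 hj
          have hhalf : ((j : ℝ) + 1) / n ≤ 1 / 2 := by
            rw [div_le_div_iff₀ hn' (by norm_num)]
            exact_mod_cast (by omega : (j + 1) * 2 ≤ 1 * n)
          exact mul_le_mul (h.le_weight (by omega)) (by linarith) (by norm_num)
            (h.weight_nonneg _ _)
      _ ≤ _ := by
          refine Finset.sum_le_sum_of_subset_of_nonneg (Finset.range_mono (by omega))
            fun j hj _ => mul_nonneg (h.weight_nonneg _ _) ?_
          rw [sub_nonneg, div_le_one hn']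
          exact_mod_cast Finset.mem_range.1 hj
  have hmass := h.sum_weight n
  rw [max_eq_left (by omega)] at hmass
  simp only [mul_sub, mul_one, Finset.sum_sub_distrib, hmass] at hmain
  linarith

theorem exists_common_mass (h : PositiveRecurrence d A D q) {R : ℝ} {i : ℕ} (hi : i < n)
    (hiR : (n : ℝ) ≤ R * ((i : ℝ) + 1)) :
    ∃ v : ℕ → ℝ, (∀ j, 0 ≤ v j ∧ v j ≤ weight D q n j ∧ v j ≤ weight D q i j) ∧
      d / A / (2 * R) ^ A ≤ ∑ j ∈ Finset.range n, v j := by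
  have hd := h.d_pos
  have hA := h.A_pos
  have hQ := h.partialSum_pos (n := n) (by omega)
  refine ⟨fun j => if j < max i 1 then d / A * (q j / partialSum q n) else 0, fun j => ?_, ?_⟩
  · have hq := h.pos j
    dsimp only
    split_ifs with hj
    · refine ⟨by positivity, h.le_weight (by omega), ?_⟩
      rcases Nat.eq_zero_or_pos i with rfl | hi0
      · obtain rfl : j = 0 := by omega
        have hdA : d / A ≤ 1 := (div_le_one hA).2 (h.d_le_one.trans h.one_le_A)
        have hq0 : q 0 / partialSum q n ≤ 1 := by
          rw [div_le_one hQ]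
          exact Finset.single_le_sum (fun j _ => (h.pos j).le) (Finset.mem_range.2 hi)
        simpa [weight] using mul_le_one₀ hdA (by positivity) hq0
      · refine le_trans ?_ (h.le_weight (by omega))
        have hQi := h.partialSum_pos hi0
        gcongr
        exact h.partialSum_mono hi.le
    · exact ⟨le_rfl, h.weight_nonneg n j, h.weight_nonneg i j⟩
  · have hI : (0 : ℝ) < (max i 1 : ℕ) := by exact_mod_cast (by omega : 0 < max i 1)
    have hQI := h.partialSum_pos (n := max i 1) (by omega)
    have hR : 0 < 2 * R := (div_pos (by exact_mod_cast i.zero_le.trans_lt hi) hI).trans_le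
      (div_max_one_le hiR)
    have hgrowth : partialSum q n ≤ partialSum q (max i 1) * (2 * R) ^ A :=
      (h.partialSum_le_mul_rpow (m := max i 1) (by omega) (by omega)).trans
        (by gcongr; exact div_max_one_le hiR)
    have hfilter : (Finset.range n).filter (· < max i 1) = Finset.range (max i 1) := by
      ext j
      simp only [Finset.mem_filter, Finset.mem_range]
      omega
    rw [← Finset.sum_filter, ← Finset.mul_sum, ← Finset.sum_div, hfilter, ← partialSum,
      div_eq_mul_one_div (d / A)]
    refine mul_le_mul_of_nonneg_left ?_ (by positivity)
    rwa [div_le_div_iff₀ (by positivity) hQ, one_mul]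

theorem harrisKernel (h : PositiveRecurrence d A D q) :
    HarrisKernel (d / 2) (4 * A ^ 2 / d ^ 2) (d / A * (1 / 2) * (1 / 3) ^ A)
      (fun R => d / A / (2 * R) ^ A) (weight D q) where
  nonneg := h.weight_nonneg
  eq_zero _ _ := weight_eq_zero
  sum_eq_one := h.sum_weight
  moment n := by
    rcases Nat.eq_zero_or_pos n with rfl | hn
    · have hd := h.d_pos
      have hA := h.one_le_A
      have : 1 ≤ 4 * A ^ 2 / d ^ 2 := by
        rw [one_le_div (by positivity)]
        nlinarith [h.d_le_one]
      simpa [weight] using this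
    · simpa only [max_eq_left (Nat.one_le_iff_ne_zero.2 hn.ne')] using h.sum_weight_rpow_le n
  drift _ := h.sum_weight_mul_div_le
  overlap _ _ _ := h.exists_common_mass

theorem sum_weight_mul_le (h : PositiveRecurrence d A D q) {p p' ε ρ X : ℝ}
    (hp : p.HolderConjugate p') (hε : 0 ≤ ε) (hε' : (1 - d + ε) * p' < 1) (hρ : 0 ≤ ρ)
    {g : ℕ → ℝ} (hg : ∀ k, 0 ≤ g k)
    (hgρ : ∑ k ∈ Finset.range n, g (k + 1) ^ p ≤ n * ρ ^ p) {b : ℕ → ℝ}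
    (hX : 0 ≤ X) (hb : ∀ j < n, b j ≤ X * ((n : ℝ) / ((j : ℝ) + 1)) ^ ε) :
    ∑ j ∈ Finset.range n, weight D q n j * (g (n - j) * b j) ≤
      2 * A ^ 2 / d * (1 / (1 - (1 - d + ε) * p')) ^ (1 / p') * ρ * X := by
  have hd := h.d_pos
  have hd1 := h.d_le_one
  have := hp.symm.pos
  rcases Nat.eq_zero_or_pos n with rfl | hn
  · have : 0 < 1 - (1 - d + ε) * p' := by linarith
    rw [Finset.sum_range_zero]
    positivity
  have : (0 : ℝ) < n := by exact_mod_cast hn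
  have hterm (j : ℕ) (hj : j ∈ Finset.range n) : weight D q n j * (g (n - j) * b j) ≤
      2 * A ^ 2 / d * (1 / n) * X * (g (n - j) * ((n : ℝ) / ((j : ℝ) + 1)) ^ (1 - d + ε)) := by
    have hj := Finset.mem_range.1 hj
    have hgj := hg (n - j)
    calc weight D q n j * (g (n - j) * b j)
        ≤ (2 * A ^ 2 / d * (1 / n) * ((n : ℝ) / ((j : ℝ) + 1)) ^ (1 - d)) *
            (g (n - j) * (X * ((n : ℝ) / ((j : ℝ) + 1)) ^ ε)) := by
          refine (mul_le_mul_of_nonneg_left (mul_le_mul_of_nonneg_left (hb j hj) hgj)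
            (h.weight_nonneg _ _)).trans (mul_le_mul_of_nonneg_right (h.weight_le hj) ?_)
          positivity
      _ = _ := by rw [Real.rpow_add (by positivity)]; ring
  have hreflect : ∑ j ∈ Finset.range n, g (n - j) ^ p ≤ n * ρ ^ p := by
    refine le_trans (le_of_eq ?_) hgρ
    rw [← Finset.sum_range_reflect]
    refine Finset.sum_congr rfl fun j hj => ?_
    have hj := Finset.mem_range.1 hj
    rw [show n - (n - 1 - j) = j + 1 by omega]
  calc _ ≤ 2 * A ^ 2 / d * (1 / n) * X *
        ∑ j ∈ Finset.range n, g (n - j) * ((n : ℝ) / ((j : ℝ) + 1)) ^ (1 - d + ε) := by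
        rw [Finset.mul_sum]
        exact Finset.sum_le_sum hterm
    _ ≤ 2 * A ^ 2 / d * (1 / n) * X *
        (n * ((1 / (1 - (1 - d + ε) * p')) ^ (1 / p') * ρ)) := by
        gcongr
        exact sum_mul_rpow_div_le hp (by linarith) hε' hρ (fun j => hg (n - j)) hreflect
    _ = _ := by field_simp

theorem pCoeff_eq (h : PositiveRecurrence d A D q) (n : ℕ) : pCoeff D n = (q n : ℂ) := by
  induction n using Nat.strong_induction_on with
  | _ n ih =>
    rcases Nat.eq_zero_or_pos n with rfl | hn
    · rw [pCoeff, expCoeff_zero, h.zero, Complex.ofReal_one]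
    refine mul_left_cancel₀ (Nat.cast_ne_zero.2 hn.ne' : (n : ℂ) ≠ 0) ?_
    rw [pCoeff, mul_expCoeff, ← Complex.ofReal_natCast, ← Complex.ofReal_mul, h.mul_eq,
      Complex.ofReal_sum]
    refine Finset.sum_congr rfl fun j hj => ?_
    rw [← pCoeff, ih j (Finset.mem_range.1 hj), Complex.ofReal_mul]

end PositiveRecurrence

theorem positiveRecurrence_pCoeff (hd : 0 < d) (hd1 : d ≤ 1) (hA : 1 ≤ A)
    (hlower : ∀ j, 1 ≤ j → d ≤ D j) (hupper : ∀ j, 1 ≤ j → D j ≤ A) :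
    PositiveRecurrence d A D fun n => (pCoeff D n).re where
  d_pos := hd
  d_le_one := hd1
  one_le_A := hA
  lower := hlower
  upper := hupper
  zero := by simp [pCoeff, expCoeff_zero]
  mul_eq n := by
    have := congrArg Complex.re (mul_expCoeff (fun j => (D j : ℂ)) n)
    rw [← Complex.ofReal_natCast, Complex.re_ofReal_mul, Complex.re_sum] at this
    simpa only [pCoeff, Complex.re_ofReal_mul] using this

end Recurrence

theorem summable_mul_pow_succ {u : ℕ → ℂ} {K : ℝ} (hu : ∀ j, ‖u j‖ ≤ K) {z : ℂ} (hz : ‖z‖ < 1) :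
    Summable fun j => u j * z ^ (j + 1) := by
  refine Summable.of_norm_bounded
    (((summable_nat_add_iff 1).2 (summable_geometric_of_lt_one (norm_nonneg z) hz)).mul_left K)
    fun j => ?_
  rw [norm_mul, norm_pow]
  gcongr
  exact hu j

theorem summable_ofReal_div_mul_pow {A : ℝ} {D : ℕ → ℝ} (hD : ∀ j, |D (j + 1)| ≤ A) {z : ℂ}
    (hz : ‖z‖ < 1) : Summable fun j => (D (j + 1) : ℂ) / ((j + 1 : ℕ) : ℂ) * z ^ (j + 1) := by
  refine summable_mul_pow_succ (K := A) (fun j => ?_) hz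
  rw [norm_div, Complex.norm_natCast, Complex.norm_real]
  exact (div_le_self (norm_nonneg _) (by simp)).trans (hD j)

section AbelMeans

variable {d A x : ℝ} {D q : ℕ → ℝ} {n : ℕ}

theorem tsum_mul_pow_succ_sub_le (hD0 : ∀ j, 1 ≤ j → 0 ≤ D j) (hDA : ∀ j, 1 ≤ j → D j ≤ A)
    (hs : ∀ t : ℝ, 0 ≤ t → t < 1 → Summable fun j : ℕ => D (j + 1) / ((j : ℝ) + 1) * t ^ (j + 1))
    (hx0 : 0 ≤ x) (hx1 : x < 1) :
    ∑' j : ℕ, D (j + 1) / ((j : ℝ) + 1) * x ^ (j + 1) ≤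
      A * Real.log 2 + ∑' j : ℕ, D (j + 1) / ((j : ℝ) + 1) * (x ^ 2) ^ (j + 1) := by
  have hA : 0 ≤ A := (hD0 1 le_rfl).trans (hDA 1 le_rfl)
  have hsq : x ^ 2 < 1 := pow_lt_one₀ hx0 hx1 two_ne_zero
  have hlog (t : ℝ) (ht0 : 0 ≤ t) (ht1 : t < 1) :
      HasSum (fun j : ℕ => t ^ (j + 1) / ((j : ℝ) + 1)) (-Real.log (1 - t)) :=
    Real.hasSum_pow_div_log_of_abs_lt_one (by rwa [abs_of_nonneg ht0])
  have hlog_two : -Real.log (1 - x) - -Real.log (1 - x ^ 2) ≤ Real.log 2 := by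
    rw [show 1 - x ^ 2 = (1 - x) * (1 + x) by ring,
      Real.log_mul (by linarith) (by linarith), sub_neg_eq_add, neg_add_cancel_left]
    exact Real.log_le_log (by linarith) (by linarith)
  rw [← sub_le_iff_le_add, ← (hs x hx0 hx1).tsum_sub (hs _ (sq_nonneg x) hsq)]
  refine le_trans ?_ (mul_le_mul_of_nonneg_left hlog_two hA)
  refine hasSum_le (fun j => ?_) ((hs x hx0 hx1).sub (hs _ (sq_nonneg x) hsq)).hasSum
    (((hlog x hx0 hx1).sub (hlog _ (sq_nonneg x) hsq)).mul_left A)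
  have hpow : (x ^ 2) ^ (j + 1) ≤ x ^ (j + 1) :=
    pow_le_pow_left₀ (sq_nonneg x) (pow_le_of_le_one hx0 hx1.le two_ne_zero) _
  calc _ = D (j + 1) * ((x ^ (j + 1) - (x ^ 2) ^ (j + 1)) / ((j : ℝ) + 1)) := by ring
    _ ≤ A * ((x ^ (j + 1) - (x ^ 2) ^ (j + 1)) / ((j : ℝ) + 1)) :=
      mul_le_mul_of_nonneg_right (hDA _ (by omega)) (div_nonneg (by linarith) (by positivity))
    _ = _ := by rw [sub_div]

theorem sq_div_mul_exp_pow_le (hn : 1 ≤ n) (j : ℕ) :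
    (((j : ℝ) + 1) / ((n : ℝ) + 1)) ^ 2 * Real.exp (-1 / n) ^ j ≤
      16 * Real.exp (-1 / (2 * n)) ^ j := by
  have hn' : (0 : ℝ) < n := by exact_mod_cast hn
  have hlin : ((j : ℝ) + 1) / ((n : ℝ) + 1) ≤ 4 * Real.exp ((j : ℝ) / (4 * n)) :=
    calc ((j : ℝ) + 1) / ((n : ℝ) + 1) ≤ 4 * ((j : ℝ) / (4 * n) + 1) := by
          rw [div_le_iff₀ (by positivity)]
          have hcancel : 4 * ((j : ℝ) / (4 * n) + 1) * (n + 1) = j + j / n + 4 * n + 4 := by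
            field_simp
            ring
          have : (0 : ℝ) ≤ j / n := by positivity
          linarith
      _ ≤ _ := by
          gcongr
          exact Real.add_one_le_exp _
  calc (((j : ℝ) + 1) / ((n : ℝ) + 1)) ^ 2 * Real.exp (-1 / n) ^ j
      ≤ (4 * Real.exp ((j : ℝ) / (4 * n))) ^ 2 * Real.exp (-1 / n) ^ j := by gcongr
    _ = 16 * (Real.exp ((j : ℝ) / (4 * n)) ^ 2 * Real.exp (-1 / n) ^ j) := by ring
    _ = _ := by
        simp only [← Real.exp_nat_mul, ← Real.exp_add]
        congr 2
        push_cast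
        field_simp
        ring

namespace PositiveRecurrence

theorem abs_le (h : PositiveRecurrence d A D q) (j : ℕ) : |D (j + 1)| ≤ A := by
  rw [abs_of_nonneg (h.d_pos.le.trans (h.lower _ (by omega)))]
  exact h.upper _ (by omega)

theorem hasSum_mul_pow (h : PositiveRecurrence d A D q) (hx0 : 0 ≤ x) (hx1 : x < 1) :
    HasSum (fun n => q n * x ^ n)
      (Real.exp (∑' j : ℕ, D (j + 1) / ((j : ℝ) + 1) * x ^ (j + 1))) := by
  have hx : ‖(x : ℂ)‖ < 1 := by rwa [Complex.norm_real, Real.norm_of_nonneg hx0]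
  rw [← Complex.hasSum_ofReal]
  convert hasSum_expCoeff (a := fun j => (D j : ℂ))
    (fun z hz => summable_ofReal_div_mul_pow h.abs_le hz) hx using 1
  · funext n
    rw [← pCoeff, h.pCoeff_eq]
    push_cast
    rfl
  · push_cast
    rfl

theorem tsum_mul_pow_le (h : PositiveRecurrence d A D q) (hx0 : 0 ≤ x) (hx1 : x < 1) :
    ∑' n, q n * x ^ n ≤ 2 ^ A * ∑' n, q n * (x ^ 2) ^ n := by
  have hs (t : ℝ) (ht0 : 0 ≤ t) (ht1 : t < 1) :
      Summable fun j : ℕ => D (j + 1) / ((j : ℝ) + 1) * t ^ (j + 1) := by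
    rw [← Complex.summable_ofReal]
    convert summable_ofReal_div_mul_pow h.abs_le
      (by rwa [Complex.norm_real, Real.norm_of_nonneg ht0] : ‖(t : ℂ)‖ < 1) using 2
    push_cast
    rfl
  rw [(h.hasSum_mul_pow hx0 hx1).tsum_eq,
    (h.hasSum_mul_pow (sq_nonneg x) (pow_lt_one₀ hx0 hx1 two_ne_zero)).tsum_eq,
    Real.rpow_def_of_pos two_pos, ← Real.exp_add, mul_comm (Real.log 2)]
  exact Real.exp_le_exp.2 (tsum_mul_pow_succ_sub_le (fun j hj => h.d_pos.le.trans (h.lower j hj))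
    h.upper hs hx0 hx1)

theorem partialSum_le_exp_one_mul_tsum (h : PositiveRecurrence d A D q) (hn : 1 ≤ n) :
    partialSum q (n + 1) ≤ Real.exp 1 * ∑' j, q j * Real.exp (-1 / n) ^ j := by
  have hn' : (0 : ℝ) < n := by exact_mod_cast hn
  have hx1 : Real.exp (-1 / n) < 1 :=
    Real.exp_lt_one_iff.2 (div_neg_of_neg_of_pos (by norm_num) hn')
  calc partialSum q (n + 1)
      ≤ ∑ j ∈ Finset.range (n + 1), Real.exp 1 * (q j * Real.exp (-1 / n) ^ j) := by
        refine Finset.sum_le_sum fun j hj => ?_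
        have hjn : (j : ℝ) ≤ n := by exact_mod_cast Nat.lt_succ_iff.1 (Finset.mem_range.1 hj)
        have hexp : 1 ≤ Real.exp 1 * Real.exp (-1 / n) ^ j := by
          rw [← Real.exp_nat_mul, ← Real.exp_add, Real.one_le_exp_iff, mul_div_assoc', mul_neg_one,
            neg_div, ← sub_eq_add_neg, sub_nonneg]
          exact (div_le_one hn').2 hjn
        rw [mul_left_comm]
        exact le_mul_of_one_le_right (h.pos j).le hexp
    _ ≤ Real.exp 1 * ∑' j, q j * Real.exp (-1 / n) ^ j := by
        rw [← Finset.mul_sum]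
        gcongr
        exact (h.hasSum_mul_pow (Real.exp_pos _).le hx1).summable.sum_le_tsum _
          fun j _ => mul_nonneg (h.pos j).le (by positivity)

theorem sum_mul_rpow_le (h : PositiveRecurrence d A D q) (n : ℕ) :
    ∑ j ∈ Finset.range (n + 1), q j * (((n : ℝ) + 1) / ((j : ℝ) + 1)) ^ (d / 2) ≤
      4 * A ^ 3 / d ^ 3 * partialSum q (n + 1) := by
  have hd := h.d_pos
  have hA := h.A_pos
  have hQ := h.partialSum_pos (n := n + 1) (by omega)
  have hmoment := h.sum_weight_rpow_le (n + 1)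
  push_cast at hmoment
  calc ∑ j ∈ Finset.range (n + 1), q j * (((n : ℝ) + 1) / ((j : ℝ) + 1)) ^ (d / 2)
      ≤ ∑ j ∈ Finset.range (n + 1), A / d * partialSum q (n + 1) *
          (weight D q (n + 1) j * (((n : ℝ) + 1) / ((j : ℝ) + 1)) ^ (d / 2)) := by
        refine Finset.sum_le_sum fun j hj => ?_
        rw [← mul_assoc]
        gcongr
        calc q j = A / d * partialSum q (n + 1) * (d / A * (q j / partialSum q (n + 1))) := by
              field_simp
          _ ≤ _ := by
              gcongr
              exact h.le_weight (Finset.mem_range.1 hj)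
    _ ≤ A / d * partialSum q (n + 1) * (4 * A ^ 2 / d ^ 2) := by
        rw [← Finset.mul_sum]
        gcongr
    _ = _ := by field_simp

theorem mul_exp_pow_mul_le (h : PositiveRecurrence d A D q) (hn : 1 ≤ n) (j : ℕ) :
    q j * Real.exp (-1 / n) ^ j *
        ((((n : ℝ) + 1) / ((j : ℝ) + 1)) ^ (d / 2) + (((j : ℝ) + 1) / ((n : ℝ) + 1)) ^ 2) ≤
      (if j ∈ Finset.range (n + 1) then q j * (((n : ℝ) + 1) / ((j : ℝ) + 1)) ^ (d / 2) else 0) +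
        q j * Real.exp (-1 / n) ^ j + 16 * (q j * Real.exp (-1 / (2 * n)) ^ j) := by
  have hd := h.d_pos
  have hq := h.pos j
  have hn' : (0 : ℝ) < n := by exact_mod_cast hn
  have hx1 : Real.exp (-1 / n) ^ j ≤ 1 := pow_le_one₀ (Real.exp_pos _).le
    (Real.exp_le_one_iff.2 (div_nonpos_of_nonpos_of_nonneg (by norm_num) hn'.le))
  have htail := mul_le_mul_of_nonneg_left (sq_div_mul_exp_pow_le hn j) hq.le
  rw [mul_add]
  refine add_le_add ?_ (by linarith)
  split_ifs with hj
  · refine le_add_of_le_of_nonneg ?_ (by positivity)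
    gcongr
    exact mul_le_of_le_one_right hq.le hx1
  · have hnj : (n : ℝ) ≤ j := by
      exact_mod_cast (by simpa using hj : n + 1 ≤ j).trans' (Nat.le_succ n)
    rw [zero_add]
    exact mul_le_of_le_one_right (by positivity)
      (Real.rpow_le_one (by positivity) ((div_le_one (by positivity)).2 (by linarith))
        (by positivity))

theorem abel_concentration (h : PositiveRecurrence d A D q) (hn : 1 ≤ n) :
    Summable (fun j => q j * Real.exp (-1 / n) ^ j *
      ((((n : ℝ) + 1) / ((j : ℝ) + 1)) ^ (d / 2) + (((j : ℝ) + 1) / ((n : ℝ) + 1)) ^ 2)) ∧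
    ∑' j, q j * Real.exp (-1 / n) ^ j *
        ((((n : ℝ) + 1) / ((j : ℝ) + 1)) ^ (d / 2) + (((j : ℝ) + 1) / ((n : ℝ) + 1)) ^ 2) ≤
      (4 * A ^ 3 / d ^ 3 * Real.exp 1 + 1 + 16 * 2 ^ A) * ∑' j, q j * Real.exp (-1 / n) ^ j := by
  have hd := h.d_pos
  have hA := h.A_pos
  have hn' : (0 : ℝ) < n := by exact_mod_cast hn
  have hlt {t : ℝ} (ht : 0 < t) : Real.exp (-1 / t) < 1 :=
    Real.exp_lt_one_iff.2 (div_neg_of_neg_of_pos (by norm_num) ht)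
  have hy : Real.exp (-1 / (2 * n)) ^ 2 = Real.exp (-1 / n) := by
    rw [← Real.exp_nat_mul]
    congr 1
    push_cast
    field_simp
  have hx := (h.hasSum_mul_pow (Real.exp_pos _).le (hlt hn')).summable
  have hhead : HasSum (fun j => if j ∈ Finset.range (n + 1) then
      q j * (((n : ℝ) + 1) / ((j : ℝ) + 1)) ^ (d / 2) else 0)
      (∑ j ∈ Finset.range (n + 1), if j ∈ Finset.range (n + 1) then
        q j * (((n : ℝ) + 1) / ((j : ℝ) + 1)) ^ (d / 2) else 0) :=
    hasSum_sum_of_ne_finset_zero fun j hj => if_neg hj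
  have hlt_two := hlt (t := 2 * n) (by positivity)
  have hy_summable := (h.hasSum_mul_pow (Real.exp_pos _).le hlt_two).summable
  have hdouble := h.tsum_mul_pow_le (Real.exp_pos _).le hlt_two
  rw [hy] at hdouble
  have hbound := (hhead.add hx.hasSum).add
    (hy_summable.hasSum.mul_left 16)
  have hsummable := Summable.of_nonneg_of_le
    (fun j => mul_nonneg (mul_nonneg (h.pos j).le (by positivity)) (by positivity))
    (h.mul_exp_pow_mul_le hn) hbound.summable
  refine ⟨hsummable, (hasSum_le (h.mul_exp_pow_mul_le hn) hsummable.hasSum hbound).trans ?_⟩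
  rw [Finset.sum_congr rfl fun j hj => if_pos hj]
  have hQ := mul_le_mul_of_nonneg_left (h.partialSum_le_exp_one_mul_tsum hn)
    (by positivity : 0 ≤ 4 * A ^ 3 / d ^ 3)
  linarith [h.sum_mul_rpow_le n]

end PositiveRecurrence

end AbelMeans

section MeanValues

theorem norm_sub_smul_le_of_hasSum {E : Type*} [NormedAddCommGroup E] [NormedSpace ℝ E]
    {c b : ℕ → ℝ} {a : ℕ → E} {α T : E} {S K : ℝ} (hc : ∀ j, 0 ≤ c j) (hS : HasSum c S)
    (hT : HasSum (fun j => c j • a j) T) (hb : Summable fun j => c j * b j)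
    (ha : ∀ j, ‖a j - α‖ ≤ K * b j) : ‖T - S • α‖ ≤ K * ∑' j, c j * b j := by
  rw [← (hT.sub (hS.smul_const α)).tsum_eq]
  refine tsum_of_norm_bounded (hb.hasSum.mul_left K) fun j => ?_
  rw [← smul_sub, norm_smul, Real.norm_of_nonneg (hc j), mul_left_comm]
  exact mul_le_mul_of_nonneg_left (ha j) (hc j)

theorem exists_eq_mul_one_add {𝕜 : Type*} [NormedField 𝕜] {m a : 𝕜} {η : ℝ} (hm : m ≠ 0)
    (hη0 : 0 ≤ η) (hη : η ≤ 1 / 2) (h : ‖m - a‖ ≤ η * ‖a‖) :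
    ∃ r, ‖r‖ ≤ 2 * η ∧ a = m * (1 + r) := by
  have hm' : 0 < ‖m‖ := norm_pos_iff.2 hm
  have hle : ‖a‖ ≤ 2 * ‖m‖ := by
    have hhalf : η * ‖a‖ ≤ 1 / 2 * ‖a‖ := by gcongr
    linarith [norm_sub_norm_le a m, norm_sub_rev a m]
  refine ⟨(a - m) / m, ?_, by field_simp; ring⟩
  rw [norm_div, div_le_iff₀ hm', norm_sub_rev]
  exact h.trans ((mul_le_mul_of_nonneg_left hle hη0).trans_eq (by ring))

theorem exists_holderConjugate_of_one_div_lt {d p : ℝ} (hd : 0 < d) (hd1 : d ≤ 1)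
    (hp : 1 / d < p) :
    ∃ p' ε : ℝ, p.HolderConjugate p' ∧ 0 < ε ∧ (1 - d + ε) * p' < 1 := by
  have hp1 : 1 < p := ((one_le_div hd).2 hd1).trans_lt hp
  have hconj := Real.HolderConjugate.conjExponent hp1
  have hp' : 0 < p.conjExponent := hconj.symm.pos
  have hlt : (1 - d) * p.conjExponent < 1 := by
    rw [Real.conjExponent, ← mul_div_assoc, div_lt_one (by linarith)]
    linarith [(div_lt_iff₀ hd).1 hp, mul_comm d p]
  refine ⟨p.conjExponent, (1 - (1 - d) * p.conjExponent) / (2 * p.conjExponent), hconj,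
    div_pos (by linarith) (by positivity), ?_⟩
  have hhalf : (1 - (1 - d) * p.conjExponent) / (2 * p.conjExponent) * p.conjExponent =
      (1 - (1 - d) * p.conjExponent) / 2 := by field_simp
  linarith

/-- For every `n`, the mean of order `p` of `‖f k - 1‖` over `1 ≤ k ≤ n` is at most `ρ`. For every
admissible exponent, finite or not, this is all that is needed of the bound on `rho`. -/
def AverageDeviationLE (f : ℕ → ℂ) (p ρ : ℝ) : Prop :=
  ∀ n : ℕ, ∑ k ∈ Finset.range n, ‖f (k + 1) - 1‖ ^ p ≤ n * ρ ^ p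

theorem averageDeviationLE_rho {f : ℕ → ℂ} {p : ℝ≥0∞} (hp0 : p ≠ 0) (hp : p ≠ ∞)
    (hf : rho f p ≠ ∞) : AverageDeviationLE f p.toReal (rho f p).toReal := by
  intro n
  have hpr : 0 < p.toReal := ENNReal.toReal_pos hp0 hp
  have hrho : ∑' j : ℕ, ‖f (j + 1) - 1‖ₑ ^ p.toReal / ((j + 1 : ℕ) : ℝ≥0∞) =
      rho f p ^ p.toReal := by
    rw [rho, if_neg hp, ← ENNReal.rpow_mul, one_div_mul_cancel hpr.ne', ENNReal.rpow_one]
  have hsum : ∑ k ∈ Finset.range n, ‖f (k + 1) - 1‖ₑ ^ p.toReal ≤ n * rho f p ^ p.toReal :=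
    calc ∑ k ∈ Finset.range n, ‖f (k + 1) - 1‖ₑ ^ p.toReal
        ≤ n * ∑ k ∈ Finset.range n, ‖f (k + 1) - 1‖ₑ ^ p.toReal / ((k + 1 : ℕ) : ℝ≥0∞) := by
          rw [Finset.mul_sum]
          refine Finset.sum_le_sum fun k hk => ?_
          have hkn : ((k + 1 : ℕ) : ℝ≥0∞) ≤ n := by exact_mod_cast Finset.mem_range.1 hk
          refine le_trans (le_of_eq ?_) (mul_le_mul_left hkn _)
          exact (ENNReal.mul_div_cancel (by exact_mod_cast k.succ_ne_zero)
            (ENNReal.natCast_ne_top _)).symm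
      _ ≤ n * rho f p ^ p.toReal := by
          rw [← hrho]
          gcongr
          exact ENNReal.sum_le_tsum _
  have hfinite : (n : ℝ≥0∞) * rho f p ^ p.toReal ≠ ∞ :=
    ENNReal.mul_ne_top (ENNReal.natCast_ne_top _) (ENNReal.rpow_ne_top_of_nonneg hpr.le hf)
  have hreal := ENNReal.toReal_mono hfinite hsum
  rw [ENNReal.toReal_sum fun k _ => ENNReal.rpow_ne_top_of_nonneg hpr.le enorm_ne_top] at hreal
  simpa [← ENNReal.toReal_rpow] using hreal

theorem averageDeviationLE_rho_top {f : ℕ → ℂ} (hf : rho f ∞ ≠ ∞) {p : ℝ} (hp : 0 ≤ p) :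
    AverageDeviationLE f p (rho f ∞).toReal := by
  intro n
  have hle (k : ℕ) : ‖f (k + 1) - 1‖ ≤ (rho f ∞).toReal := by
    have hk : ‖f (k + 1) - 1‖ₑ ≤ rho f ∞ := by
      rw [rho, if_pos rfl]
      exact le_iSup (fun j : ℕ => ‖f (j + 1) - 1‖ₑ) k
    simpa using ENNReal.toReal_mono hf hk
  calc ∑ k ∈ Finset.range n, ‖f (k + 1) - 1‖ ^ p
      ≤ ∑ _k ∈ Finset.range n, (rho f ∞).toReal ^ p :=
        Finset.sum_le_sum fun k _ => Real.rpow_le_rpow (norm_nonneg _) (hle k) hp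
    _ = n * (rho f ∞).toReal ^ p := by simp

variable {d A p ρ : ℝ} {D q : ℕ → ℝ} {f : ℕ → ℂ}

theorem AverageDeviationLE.norm_sub_one_le (hf : AverageDeviationLE f p ρ) (hp : 1 ≤ p)
    (hρ : 0 ≤ ρ) (j : ℕ) : ‖f (j + 1) - 1‖ ≤ ((j : ℝ) + 1) * ρ := by
  have hp0 : 0 < p := one_pos.trans_le hp
  rw [← Real.rpow_le_rpow_iff (norm_nonneg _) (by positivity) hp0,
    Real.mul_rpow (by positivity) hρ]
  calc ‖f (j + 1) - 1‖ ^ p ≤ ∑ k ∈ Finset.range (j + 1), ‖f (k + 1) - 1‖ ^ p :=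
        Finset.single_le_sum (f := fun k => ‖f (k + 1) - 1‖ ^ p) (fun k _ => by positivity)
          (Finset.self_mem_range_succ j)
    _ ≤ ((j : ℝ) + 1) * ρ ^ p := by exact_mod_cast hf (j + 1)
    _ ≤ ((j : ℝ) + 1) ^ p * ρ ^ p := by
        gcongr
        exact Real.self_le_rpow_of_one_le (by simp) hp

theorem summable_LTerm (hD : ∀ j, |D (j + 1)| ≤ A)
    (hf : ∀ j : ℕ, ‖f (j + 1) - 1‖ ≤ ((j : ℝ) + 1) * ρ) {z : ℂ} (hz : ‖z‖ < 1) :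
    Summable (LTerm D f z) := by
  refine summable_mul_pow_succ (K := A * ρ) (fun j => ?_) hz
  rw [norm_mul, norm_div, Complex.norm_real, Complex.norm_natCast]
  refine mul_le_mul (hD j) ?_ (by positivity) ((abs_nonneg _).trans (hD j))
  rw [div_le_iff₀ (by positivity), mul_comm]
  exact_mod_cast hf j

theorem hasSum_MCoeff_mul_pow (hD : ∀ j, |D (j + 1)| ≤ A)
    (hf : ∀ j : ℕ, ‖f (j + 1) - 1‖ ≤ ((j : ℝ) + 1) * ρ) {z : ℂ} (hz : ‖z‖ < 1) :
    HasSum (fun n => MCoeff D f n * z ^ n) (mFun D f z * ∑' n, pCoeff D n * z ^ n) := by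
  have hterm (w : ℂ) (j : ℕ) : LTerm D f w j + (D (j + 1) : ℂ) / ((j + 1 : ℕ) : ℂ) * w ^ (j + 1) =
      (D (j + 1) : ℂ) * f (j + 1) / ((j + 1 : ℕ) : ℂ) * w ^ (j + 1) := by
    rw [LTerm]
    ring
  have hp : HasSum (fun n => pCoeff D n * z ^ n) _ :=
    hasSum_expCoeff (a := fun j => (D j : ℂ)) (fun w hw => summable_ofReal_div_mul_pow hD hw) hz
  have hsummable (w : ℂ) (hw : ‖w‖ < 1) : Summable fun j =>
      (D (j + 1) : ℂ) * f (j + 1) / ((j + 1 : ℕ) : ℂ) * w ^ (j + 1) := by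
    simpa only [hterm] using (summable_LTerm hD hf hw).add (summable_ofReal_div_mul_pow hD hw)
  rw [hp.tsum_eq, mFun, ← Complex.exp_add,
    ← (summable_LTerm hD hf hz).tsum_add (summable_ofReal_div_mul_pow hD hz)]
  simpa only [hterm, MCoeff] using hasSum_expCoeff (a := fun j => (D j : ℂ) * f j) hsummable hz

/-- The ratio `M_n / p_n`, a mean value of the multiplicative function with values `f`. -/
noncomputable def meanRatio (D : ℕ → ℝ) (f : ℕ → ℂ) (n : ℕ) : ℂ := MCoeff D f n / pCoeff D n

/-- The error made by replacing `f` by `1` in the recurrence for `meanRatio D f`. -/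
noncomputable def meanError (D q : ℕ → ℝ) (f : ℕ → ℂ) (n : ℕ) : ℂ :=
  ∑ j ∈ Finset.range n, weight D q n j • ((f (n - j) - 1) * meanRatio D f j)

namespace PositiveRecurrence

theorem MCoeff_eq (h : PositiveRecurrence d A D q) (n : ℕ) :
    MCoeff D f n = q n * meanRatio D f n := by
  rw [meanRatio, h.pCoeff_eq, mul_div_cancel₀]
  exact_mod_cast (h.pos n).ne'

theorem isPastAverage (h : PositiveRecurrence d A D q) (f : ℕ → ℂ) :
    IsPastAverage (weight D q) (meanRatio D f) (meanError D q f) := by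
  intro n
  rcases Nat.eq_zero_or_pos n with rfl | hn
  · simp [meanError, weight]
  have hn' : (n : ℂ) ≠ 0 := Nat.cast_ne_zero.2 hn.ne'
  have hq : (q n : ℂ) ≠ 0 := by exact_mod_cast (h.pos n).ne'
  have hrec : (n : ℂ) * MCoeff D f n =
      ∑ j ∈ Finset.range n, (D (n - j) : ℂ) * f (n - j) * MCoeff D f j := mul_expCoeff _ n
  have hratio : meanRatio D f n = (n : ℂ) * MCoeff D f n / (n * q n) := by
    rw [h.MCoeff_eq]
    field_simp
  rw [max_eq_left hn, meanError, ← Finset.sum_add_distrib, hratio, hrec, Finset.sum_div]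
  refine Finset.sum_congr rfl fun j hj => ?_
  rw [weight_of_lt (Finset.mem_range.1 hj), h.MCoeff_eq, Complex.real_smul, Complex.real_smul]
  push_cast
  ring

theorem isPastError (h : PositiveRecurrence d A D q) {p' ε : ℝ} (hp : p.HolderConjugate p')
    (hε : 0 ≤ ε) (hε' : (1 - d + ε) * p' < 1) (hρ : 0 ≤ ρ) (hf : AverageDeviationLE f p ρ) :
    IsPastError (meanRatio D f) (meanError D q f)
      (2 * A ^ 2 / d * (1 / (1 - (1 - d + ε) * p')) ^ (1 / p') * ρ) ε := by
  intro n _ X hX hb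
  refine (norm_sum_le _ _).trans (le_trans (Finset.sum_le_sum fun j _ => ?_)
    (h.sum_weight_mul_le hp hε hε' hρ (g := fun k => ‖f k - 1‖) (fun k => norm_nonneg _) (hf n)
      hX hb))
  rw [norm_smul, norm_mul, Real.norm_of_nonneg (h.weight_nonneg n j)]

theorem norm_mFun_sub_meanRatio_le (h : PositiveRecurrence d A D q)
    (hf : ∀ j : ℕ, ‖f (j + 1) - 1‖ ≤ ((j : ℝ) + 1) * ρ) {τ ε : ℝ}
    (ho : ∀ n, OscillationBelow (meanRatio D f) τ ε n) (hτ : 0 ≤ τ) (hτ8 : τ ≤ 1 / 8) (hε : ε ≤ 1)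
    (hεd : ε ≤ d / 2) {n : ℕ} (hn : 1 ≤ n) :
    ‖mFun D f (Real.exp (-1 / n) : ℝ) - meanRatio D f n‖ ≤
      2 * τ * (4 * A ^ 3 / d ^ 3 * Real.exp 1 + 1 + 16 * 2 ^ A) * ‖meanRatio D f n‖ := by
  obtain ⟨hconc, hconc_le⟩ := h.abel_concentration hn
  have hx1 : Real.exp (-1 / n) < 1 :=
    Real.exp_lt_one_iff.2 (div_neg_of_neg_of_pos (by norm_num) (by exact_mod_cast hn))
  set x := Real.exp (-1 / n)
  have hx0 : 0 < x := Real.exp_pos _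
  have hx : ‖(x : ℂ)‖ < 1 := by rwa [Complex.norm_real, Real.norm_of_nonneg hx0.le]
  have hq := h.hasSum_mul_pow hx0.le hx1
  have hS := hq.summable.hasSum
  have hS0 : 0 < ∑' j, q j * x ^ j := hq.tsum_eq ▸ Real.exp_pos _
  have hM : HasSum (fun j => (q j * x ^ j) • meanRatio D f j)
      (mFun D f x * (∑' j, q j * x ^ j : ℝ)) := by
    convert hasSum_MCoeff_mul_pow h.abs_le hf hx using 2 with j
    · rw [h.MCoeff_eq, Complex.real_smul]
      push_cast
      ring
    · simp only [h.pCoeff_eq]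
      push_cast
      rfl
  have hdiff := norm_sub_smul_le_of_hasSum (fun j => mul_nonneg (h.pos j).le (by positivity)) hS hM
    hconc fun j => norm_sub_le_rpow_add_sq ho hτ hτ8 hε hεd j n
  rw [Complex.real_smul, mul_comm, ← mul_sub, norm_mul, Complex.norm_real,
    Real.norm_of_nonneg hS0.le] at hdiff
  refine le_of_mul_le_mul_left (hdiff.trans ?_) hS0
  calc _ ≤ 2 * τ * ‖meanRatio D f n‖ *
        ((4 * A ^ 3 / d ^ 3 * Real.exp 1 + 1 + 16 * 2 ^ A) * ∑' j, q j * x ^ j) := by gcongr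
    _ = _ := by ring

end PositiveRecurrence

theorem exists_mean_value_bound (hd : 0 < d) (hd1 : d ≤ 1) (hA : 1 ≤ A) (hp : 1 / d < p) :
    ∃ δ : ℝ, 0 < δ ∧ ∃ C : ℝ, 0 < C ∧
      ∀ D : ℕ → ℝ, (∀ j, 1 ≤ j → d ≤ D j) → (∀ j, 1 ≤ j → D j ≤ A) →
      ∀ (f : ℕ → ℂ) (ρ : ℝ), 0 ≤ ρ → ρ ≤ δ → AverageDeviationLE f p ρ →
        (∀ z : ℂ, ‖z‖ < 1 → Summable (LTerm D f z)) ∧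
        ∀ n : ℕ, 1 ≤ n → ∃ r : ℂ, ‖r‖ ≤ C * ρ ∧
          MCoeff D f n / pCoeff D n = mFun D f (Real.exp (-1 / (n : ℝ)) : ℝ) * (1 + r) := by
  obtain ⟨p', ε₀, hpp', hε₀, hε₀p'⟩ := exists_holderConjugate_of_one_div_lt hd hd1 hp
  obtain ⟨ε, B, δ, _, _, hε1, hεd, hB, hδ, hBδ, hosc⟩ :=
    exists_oscillation_bound (C := 4 * A ^ 2 / d ^ 2) (c := d / A * (1 / 2) * (1 / 3) ^ A)
      (κ := fun R => d / A / (2 * R) ^ A) (half_pos hd) (by linarith) (by positivity)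
      (by positivity) (fun R hR => by positivity) hε₀
  set C₁ := 2 * A ^ 2 / d * (1 / (1 - (1 - d + ε₀) * p')) ^ (1 / p')
  set C₂ := 4 * A ^ 3 / d ^ 3 * Real.exp 1 + 1 + 16 * 2 ^ A
  have hC₁ : 0 < C₁ := by
    have : 0 < 1 - (1 - d + ε₀) * p' := by linarith
    positivity
  have : 0 < C₂ := by positivity
  refine ⟨min (δ / C₁) (1 / (4 * B * C₁ * C₂)), by positivity, 4 * B * C₁ * C₂, by positivity,
    fun D hlower hupper f ρ hρ hρδ hf => ?_⟩
  have h := positiveRecurrence_pCoeff hd hd1 hA hlower hupper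
  have hf' := hf.norm_sub_one_le hpp'.lt.le hρ
  have hσδ : C₁ * ρ ≤ δ := (le_div_iff₀' hC₁).1 (hρδ.trans (min_le_left _ _))
  have hsmall : ρ * (4 * B * C₁ * C₂) ≤ 1 :=
    (le_div_iff₀ (by positivity)).1 (hρδ.trans (min_le_right _ _))
  have hτ : B * (C₁ * ρ) ≤ 1 / 8 := (mul_le_mul_of_nonneg_left hσδ hB.le).trans hBδ
  have ho := hosc ℂ (weight D fun n => (pCoeff D n).re) (meanRatio D f) _ (C₁ * ρ) (by positivity)
    hσδ h.harrisKernel (h.isPastAverage f) (h.isPastError hpp' hε₀.le hε₀p' hρ hf)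
  refine ⟨fun z hz => summable_LTerm h.abs_le hf' hz, fun n hn => ?_⟩
  obtain ⟨r, hr, hr_eq⟩ := exists_eq_mul_one_add (Complex.exp_ne_zero _) (by positivity)
    (by linarith) (h.norm_mFun_sub_meanRatio_le hf' ho (by positivity) hτ hε1 hεd hn)
  exact ⟨r, hr.trans_eq (by ring), hr_eq⟩

end MeanValues

end MeanValue

theorem mainTheorem7 (dm dp : ℝ) (hdm : 0 < dm) (p : ℝ≥0∞)
    (hp : ENNReal.ofReal (max 1 (1 / dm)) < p) :
    ∃ δ : ℝ, 0 < δ ∧ ∃ C : ℝ, 0 < C ∧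
      ∀ d : ℕ → ℝ, (∀ j : ℕ, 1 ≤ j → dm ≤ d j ∧ d j ≤ dp) →
      ∀ f : ℕ → ℂ, MeanValue.rho f p ≤ ENNReal.ofReal δ →
        (∀ z : ℂ, ‖z‖ < 1 → Summable (MeanValue.LTerm d f z)) ∧
        ∀ n : ℕ, 1 ≤ n →
          ∃ r : ℂ, ‖r‖ ≤ C * (MeanValue.rho f p).toReal ∧
            MeanValue.MCoeff d f n / MeanValue.pCoeff d n =
              MeanValue.mFun d f ((Real.exp (-1 / (n : ℝ)) : ℝ) : ℂ) * (1 + r) := by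
  have hmin : 0 < min dm 1 := lt_min hdm one_pos
  have hmax : 1 / min dm 1 ≤ max 1 (1 / dm) := by
    rcases min_choice dm 1 with h | h <;> simp [h]
  obtain ⟨p₀, hp₀, hrho⟩ : ∃ p₀ : ℝ, 1 / min dm 1 < p₀ ∧ ∀ f : ℕ → ℂ, MeanValue.rho f p ≠ ∞ →
      MeanValue.AverageDeviationLE f p₀ (MeanValue.rho f p).toReal := by
    rcases eq_or_ne p ∞ with rfl | hp_top
    · exact ⟨1 / min dm 1 + 1, lt_add_one _, fun f hf =>
        MeanValue.averageDeviationLE_rho_top hf (by positivity)⟩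
    · exact ⟨p.toReal,
        hmax.trans_lt ((ENNReal.ofReal_lt_iff_lt_toReal (by positivity) hp_top).1 hp),
        fun f hf => MeanValue.averageDeviationLE_rho (ne_bot_of_gt hp) hp_top hf⟩
  obtain ⟨δ, hδ, C, hC, hbound⟩ := MeanValue.exists_mean_value_bound hmin (min_le_right _ _)
    (le_max_right dp 1) hp₀
  refine ⟨δ, hδ, C, hC, fun d hd f hf => ?_⟩
  exact hbound d (fun j hj => (min_le_left _ _).trans (hd j hj).1)
    (fun j hj => (hd j hj).2.trans (le_max_left _ _)) f _ ENNReal.toReal_nonneg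
    (ENNReal.toReal_le_of_le_ofReal hδ.le hf)
    (hrho f (ne_top_of_le_ne_top ENNReal.ofReal_ne_top hf))
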